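/- Let $G=(V,E)$ be an infinite, connected, locally finite, transitive graph that is unimodular: for all $x,y\in V$, $|\{f(y): f\in\mathrm{Aut}(G), f(x)=x\}|=|\{f(x): f\in\mathrm{Aut}(G), f(y)=y\}|$. A path is a function $y:[0,\infty)\to V$ for which there are times $0=t_0<t_1<\dots\to\infty$ and vertices $v_i$ with $y\equiv v_i$ on $[t_i,t_{i+1})$ and $(v_i,v_{i+1})\in E$. For each $v$ let $\nu_v$ be a distribution on paths started at $v$, invariant in the sense that $\gamma\circ\nu_v=\nu_{\gamma v}$ for all $\gamma\in\mathrm{Aut}(G)$, and such that the range of a $\nu_v$-random path is a.s. infinite. Let $\mu$ be a probability distribution on $\mathbb N=\{0,1,2,\dots\}$ with mean $\mathbb E(\mu)\in[0,\infty]$. Model. The numbers $N_v$ of particles starting at the vertices $v$ are i.i.d. with law $\mu$; independently, the particles $(v,i)$, $i<N_v$, have independent putative paths $y^{v,i}$ with law $\nu_v$ and independent random marks with a common law. The actual path of a particle is $x^{v,i}_t=y^{v,i}_{\tau^{v,i}(t)}$, where the inner time $\tau^{v,i}(t)$ is the integral over $[0,t]$ of a rate in $[0,\infty)$, which at time $s$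 is a given automorphism-invariant function (the interaction rule) of the actual paths up to time $s$ and the marks of all particles. A particle is active at time $t$ if its rate is positive at time $t$. The model is assumed to be well defined, unique and local: there is a measurable function of the random input that is a.s. the unique solution of these dynamics for which every vertex is visited by only finitely many particles in any finite time interval. In the generalized activated random walk with sleeping rate $\lambda>0$ the mark of a particle is a Poisson process of rate $\lambda$; a particle becomes inactive when its Poisson process rings while it is alone at its vertex, becomes active again as soon as another particle is at its vertex, and has rate $1$ while active and $0$ while inactive. The model is vertex-fixating if for every vertex $v$, a.s. there is a time after which there are no active particles at $v$. A particle fixates at $v$ if from some time on it is not active and is located at $v$. Then: 1. If the generalized activated random walk is vertex-fixating, then $\mathbb E(\mu)\le 1$. 2. The same holds for every model with an automorphism-invariant interaction rule in which, for every vertex, a.s. at most one particle fixates at that vertex: if it is vertex-fixating, then $\mathbb E(\mu)\le 1$. 3. Consequently the critical density is at most $1$: for every class $M$ of initial distributions (such as the Poisson distributions), the supremum of $\mathbb E(\mu)$ over those $\mu\in M$ for which the model is well defined, unique, local and vertex-fixating is at most $1$, for the generalized activated random walk with any $\lambda>0$, and for every interaction rule as in 2 for which the condition in 2 holds for every $\mu\in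 M$ for which the model is well defined, unique and local. -/

import Mathlib

open MeasureTheory ProbabilityTheory Filter
open scoped NNReal ENNReal

noncomputable section

namespace ARW

/-! ### Graphs -/

/-- Connected, locally finite, transitive graphs which are unimodular: the orbit of `y` under the
stabilizer of `x` has the same size as the orbit of `x` under the stabilizer of `y`. -/
structure IsUnimodularTransitive {V : Type*} (G : SimpleGraph V) : Prop where
  connected : G.Connected
  locallyFinite : ∀ v, (G.neighborSet v).Finite
  transitive : ∀ x y, ∃ γ : G ≃g G, γ x = y
  unimodular : ∀ x y,
    {z | ∃ γ : G ≃g G, γ x = x ∧ γ y = z}.encard = {z | ∃ γ : G ≃g G, γ y = y ∧ γ x = z}.encard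

/-! ### Paths and path distributions -/

/-- `y` is a path: there are jump times `0 = t 0 < t 1 < ⋯ → ∞` such that `y` is constant between
consecutive jump times, and its successive values are adjacent. -/
def IsPath {V : Type*} (G : SimpleGraph V) (y : ℝ≥0 → V) : Prop :=
  ∃ (t : ℕ → ℝ≥0) (v : ℕ → V), t 0 = 0 ∧ StrictMono t ∧ Tendsto t atTop atTop ∧
    (∀ i, ∀ s ∈ Set.Ico (t i) (t (i + 1)), y s = v i) ∧ ∀ i, G.Adj (v i) (v (i + 1))

/-- The space of paths in `G`. -/
def Path {V : Type*} (G : SimpleGraph V) : Type _ := {y : ℝ≥0 → V // IsPath G y}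

/-- The σ-algebra on paths generated by the evaluation maps. -/
instance Path.measurableSpace {V : Type*} (G : SimpleGraph V) : MeasurableSpace (Path G) :=
  ⨆ s : ℝ≥0, MeasurableSpace.comap (fun y : Path G => y.1 s) ⊤

/-- The image of a path under a graph automorphism. -/
def Path.map {V : Type*} {G : SimpleGraph V} (γ : G ≃g G) (y : Path G) : Path G :=
  ⟨fun s => γ (y.1 s), by
    obtain ⟨t, v, h0, hm, ht, hc, ha⟩ := y.2
    exact ⟨t, fun i => γ (v i), h0, hm, ht, fun i s hs => congrArg γ (hc i s hs),
      fun i => γ.map_adj_iff.2 (ha i)⟩⟩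

/-- `ν v` is the distribution of the putative path of a particle started at `v`. Invariance:
`γ ∘ ν v = ν (γ v)` for all automorphisms `γ`. On a transitive graph such a family is the same
thing as a single distribution, for one starting vertex, invariant under the stabilizer of that
vertex, transported to the other vertices by automorphisms. -/
structure IsInvariantPathLaw {V : Type*} {G : SimpleGraph V}
    (ν : V → ProbabilityMeasure (Path G)) : Prop where
  start : ∀ v, ∀ᵐ y ∂(ν v : Measure (Path G)), y.1 0 = v
  invariant : ∀ (γ : G ≃g G) (v : V),
    (ν v : Measure (Path G)).map (Path.map γ) = (ν (γ v) : Measure (Path G))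

/-- The range of a sampled path is almost surely infinite. -/
def HasInfiniteRange {V : Type*} {G : SimpleGraph V}
    (ν : V → ProbabilityMeasure (Path G)) : Prop :=
  ∀ v, ∀ᵐ y ∂(ν v : Measure (Path G)), (Set.range y.1).Infinite

/-! ### The random input of a model -/

/-- Particles are named `(v, i)`: the `i`-th particle started at `v`. An input consists of the
number of particles at every vertex, and of a putative path and a mark for every name. The marks
are the additional randomness available to the interaction. -/
abbrev Input {V : Type*} (G : SimpleGraph V) (S : Type*) : Type _ :=
  (V → ℕ) × (V × ℕ → Path G × S)

/-- The numbers of particles are i.i.d. with law `μ`, and, independently of them, all putative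
paths and marks are independent, with laws `ν v` for a start at `v` and `ρ`, respectively. -/
def inputLaw {V S : Type*} {G : SimpleGraph V} [MeasurableSpace S] (μ : ProbabilityMeasure ℕ)
    (ν : V → ProbabilityMeasure (Path G)) (ρ : ProbabilityMeasure S) : Measure (Input G S) :=
  (Measure.infinitePi fun _ : V => (μ : Measure ℕ)).prod
    (Measure.infinitePi fun p : V × ℕ => (ν p.1 : Measure (Path G)).prod (ρ : Measure S))

/-- The particle `p` exists. -/
def Present {V S : Type*} {G : SimpleGraph V} (ω : Input G S) (p : V × ℕ) : Prop :=
  p.2 < ω.1 p.1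

/-! ### Interaction rules and the dynamics -/

/-- What an interaction rule sees: for every existing particle its actual path and its mark
(`none` for names `(v, i)` without a particle). -/
abbrev History (V S : Type*) : Type _ := V × ℕ → Option ((ℝ≥0 → V) × S)

/-- The image of a history under an automorphism. -/
def History.map {V S : Type*} {G : SimpleGraph V} (γ : G ≃g G) (h : History V S) : History V S :=
  fun p => (h (γ.symm p.1, p.2)).map fun z => (fun s => γ (z.1 s), z.2)

/-- An interaction rule: the rate at which a particle progresses along its putative path at a
given time, as a function of the history up to that time. -/
abbrev Rule (V S : Type*) : Type _ := V × ℕ → ℝ≥0 → History V S → ℝ≥0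

/-- Automorphism invariance of an interaction rule. -/
def Rule.IsInvariant {V S : Type*} (G : SimpleGraph V) (R : Rule V S) : Prop :=
  ∀ (γ : G ≃g G) (p : V × ℕ) (t : ℝ≥0) (h : History V S),
    R (γ p.1, p.2) t (History.map γ h) = R p t h

/-- The position of a particle at time `t`, where `τ p t` is the inner time of `p` at time `t`. -/
def position {V S : Type*} {G : SimpleGraph V} (ω : Input G S) (τ : V × ℕ → ℝ≥0 → ℝ≥0)
    (p : V × ℕ) (t : ℝ≥0) : V :=
  (ω.2 p).1.1 (τ p t)

open Classical in
/-- The history up to time `t`: actual paths are stopped at time `t`. -/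
def historyUpTo {V S : Type*} {G : SimpleGraph V} (ω : Input G S) (τ : V × ℕ → ℝ≥0 → ℝ≥0)
    (t : ℝ≥0) : History V S :=
  fun p => if Present ω p then some (fun s => position ω τ p (min s t), (ω.2 p).2) else none

/-- The rate of the particle `p` at time `t`. -/
def rate {V S : Type*} {G : SimpleGraph V} (R : Rule V S) (ω : Input G S)
    (τ : V × ℕ → ℝ≥0 → ℝ≥0) (p : V × ℕ) (t : ℝ≥0) : ℝ≥0 :=
  R p t (historyUpTo ω τ t)

/-- The inner times `τ` follow the rule `R` on the input `ω`: the inner time of every existing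
particle is the integral of its rate. -/
def IsSolution {V S : Type*} {G : SimpleGraph V} (R : Rule V S) (ω : Input G S)
    (τ : V × ℕ → ℝ≥0 → ℝ≥0) : Prop :=
  ∀ p, Present ω p → ∀ t : ℝ≥0,
    IntervalIntegrable (fun s : ℝ => (rate R ω τ p s.toNNReal : ℝ)) volume 0 t ∧
    (τ p t : ℝ) = ∫ s in (0 : ℝ)..t, (rate R ω τ p s.toNNReal : ℝ)

/-- Every vertex is visited by only finitely many particles in any finite time interval. -/
def IsLocal {V S : Type*} {G : SimpleGraph V} (ω : Input G S) (τ : V × ℕ → ℝ≥0 → ℝ≥0) : Prop :=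
  ∀ (v : V) (T : ℝ≥0), {p | Present ω p ∧ ∃ t ≤ T, position ω τ p t = v}.Finite

/-- The model with rule `R`, initial distribution `μ`, path distribution `ν` and mark distribution
`ρ` is well defined, unique and local, and `Φ` is the resulting process: a measurable function of
the input which is, almost surely, the unique local solution of the dynamics. -/
structure IsRealization {V S : Type*} {G : SimpleGraph V} [MeasurableSpace S] (R : Rule V S)
    (μ : ProbabilityMeasure ℕ) (ν : V → ProbabilityMeasure (Path G)) (ρ : ProbabilityMeasure S)
    (Φ : Input G S → V × ℕ → ℝ≥0 → ℝ≥0) : Prop where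
  measurable : ∀ p t, Measurable fun ω => Φ ω p t
  solution : ∀ᵐ ω ∂inputLaw μ ν ρ, IsSolution R ω (Φ ω)
  isLocal : ∀ᵐ ω ∂inputLaw μ ν ρ, IsLocal ω (Φ ω)
  unique : ∀ᵐ ω ∂inputLaw μ ν ρ, ∀ τ, IsSolution R ω τ → IsLocal ω τ →
    ∀ p, Present ω p → τ p = Φ ω p

/-! ### Fixation -/

/-- The particle `p` is active at time `t`: it progresses along its putative path. -/
def Active {V S : Type*} {G : SimpleGraph V} (R : Rule V S) (ω : Input G S)
    (τ : V × ℕ → ℝ≥0 → ℝ≥0) (p : V × ℕ) (t : ℝ≥0) : Prop :=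
  Present ω p ∧ 0 < rate R ω τ p t

/-- Almost surely, from some time on there are no active particles at `v`; this for every `v`. -/
def VertexFixating {V S : Type*} {G : SimpleGraph V} [MeasurableSpace S] (R : Rule V S)
    (μ : ProbabilityMeasure ℕ) (ν : V → ProbabilityMeasure (Path G)) (ρ : ProbabilityMeasure S)
    (Φ : Input G S → V × ℕ → ℝ≥0 → ℝ≥0) : Prop :=
  ∀ v, ∀ᵐ ω ∂inputLaw μ ν ρ, ∃ T : ℝ≥0, ∀ t > T, ∀ p,
    position ω (Φ ω) p t = v → ¬ Active R ω (Φ ω) p t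

/-- The particle `p` fixates at the vertex `v`. -/
def FixatesAt {V S : Type*} {G : SimpleGraph V} (R : Rule V S) (ω : Input G S)
    (τ : V × ℕ → ℝ≥0 → ℝ≥0) (p : V × ℕ) (v : V) : Prop :=
  Present ω p ∧ ∃ T : ℝ≥0, ∀ t > T, ¬ Active R ω τ p t ∧ position ω τ p t = v

/-- At every vertex, almost surely, at most one particle fixates. -/
def AtMostOneFixates {V S : Type*} {G : SimpleGraph V} [MeasurableSpace S] (R : Rule V S)
    (μ : ProbabilityMeasure ℕ) (ν : V → ProbabilityMeasure (Path G)) (ρ : ProbabilityMeasure S)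
    (Φ : Input G S → V × ℕ → ℝ≥0 → ℝ≥0) : Prop :=
  ∀ v, ∀ᵐ ω ∂inputLaw μ ν ρ, ∀ p q,
    FixatesAt R ω (Φ ω) p v → FixatesAt R ω (Φ ω) q v → p = q

/-! ### Densities -/

/-- The mean initial density `E(μ)`. -/
def meanDensity (μ : ProbabilityMeasure ℕ) : ℝ≥0∞ := ∫⁻ n, (n : ℝ≥0∞) ∂(μ : Measure ℕ)

/-- The critical density along a class `M` of initial distributions (for example, all Poisson
distributions): the supremum of the densities of those `μ` in `M` for which the model is
(well defined, unique, local and) vertex-fixating. -/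
def criticalDensity {V S : Type*} {G : SimpleGraph V} [MeasurableSpace S] (R : Rule V S)
    (ν : V → ProbabilityMeasure (Path G)) (ρ : ProbabilityMeasure S)
    (M : Set (ProbabilityMeasure ℕ)) : ℝ≥0∞ :=
  sSup {d | ∃ μ ∈ M, meanDensity μ = d ∧
    ∃ Φ, IsRealization R μ ν ρ Φ ∧ VertexFixating R μ ν ρ Φ}

/-! ### Generalized activated random walks -/

/-- The law of a Poisson process of rate `r`, given by its independent exponential gaps. -/
def poissonClock (r : ℝ) (hr : 0 < r) : ProbabilityMeasure (ℕ → ℝ) :=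
  haveI := isProbabilityMeasure_expMeasure hr
  ⟨Measure.infinitePi fun _ : ℕ => expMeasure r, inferInstance⟩

/-- The time `s` is a point of the point process with the gaps `c`. -/
def IsRing (c : ℕ → ℝ) (s : ℝ≥0) : Prop :=
  ∃ k : ℕ, (s : ℝ) = ∑ j ∈ Finset.range (k + 1), c j

/-- In the history `h`, a particle `p` with path `x` shares its vertex with no other particle at
time `s`. -/
def IsAlone {V S : Type*} (h : History V S) (p : V × ℕ) (x : ℝ≥0 → V) (s : ℝ≥0) : Prop :=
  ∀ q, q ≠ p → ∀ z, h q = some z → z.1 s ≠ x s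

open Classical in
/-- The rule of generalized activated random walk. The mark of a particle is its clock. A particle
becomes inactive when its clock rings while it is alone at its vertex, and it becomes active again
as soon as another particle is at its vertex; so it is inactive at time `t` if and only if its
clock has rung at some time `s ≤ t` such that it has been alone throughout `[s, t]`. Active
particles have rate `1`, inactive particles have rate `0`. -/
def garwRule (V : Type*) : Rule V (ℕ → ℝ) := fun p t h =>
  match h p with
  | none => 0
  | some z =>
    if ∃ s ≤ t, IsRing z.2 s ∧ ∀ r ∈ Set.Icc s t, IsAlone h p z.1 r then 0 else 1

end ARW

end

/-!
The proof rests on two applications of the mass-transport principle `ARW.mass_transport`: on a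
unimodular transitive graph, the mass that a vertex sends under a diagonally invariant transport
equals the mass that it receives. The invariance of all transports used here comes from the
invariance of the law of the input and from the uniqueness of the local solution, which makes the
process equivariant (`ARW.IsRealization.ae_input_map`).

*Every particle fixates* (`ARW.measure_endlessEvent`, `ARW.ae_particle_fixation`). A particle whose
inner time stays bounded settles at some vertex, and vertex fixation makes it inactive there. So
suppose that the `i`-th particle of a vertex has unbounded inner time with probability `a > 0`. Such
a particle follows its whole putative path, hence visits infinitely many vertices. Let it spread
unit mass uniformly over the set of vertices seen at the first `n + 1` times of a dense sequence; as
`n → ∞` this set grows without bound, so that each vertex gets little mass from each particle. By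
vertex fixation and locality, a vertex is visited by only finitely many endless particles
(`ARW.finite_endless_visitors`), so the mass `S n` which it receives tends to `0` almost surely;
by mass transport the mean of `S n` is `a` for all `n`.

This contradicts independence. Up to an error with mean at most `ε`, the indicator that the particle
of `x` is endless can be replaced by its conditional expectation given the input in the ball of
radius `N` around `x` (Lévy's upward theorem, with the same `N` for all `x`). After this replacement
the contributions of `x` and `x'` are independent unless the two balls meet, so that the received
mass `Z n` has a second moment bounded in `n` (`ARW.lintegral_sq_tsum_le`). Hence the `Z n` are
uniformly integrable, and `S n → 0` forces `a ≤ 3 ε` (`ARW.mean_le_of_tendsto_zero`).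

*The density is at most one* (`ARW.meanDensity_le_one`). Now let every particle send unit mass to the
vertex where it fixates. A vertex sends mass `meanDensity μ` on average, and it receives at most `1`
when at most one particle fixates there. In generalized activated random walk two particles cannot
both rest at the same vertex, since a particle that shares its vertex is active.
-/

noncomputable section

namespace ARW

/-! ### Balls and mass transport in unimodular graphs -/

section Graph

variable {V : Type*} {G : SimpleGraph V}

/-- The closed ball of radius `n` around `x` in the graph metric. -/
def ball (G : SimpleGraph V) (x : V) (n : ℕ) : Set V := {u | G.dist x u ≤ n}

theorem dist_iso (hG : G.Connected) (γ : G ≃g G) (x y : V) : G.dist (γ x) (γ y) = G.dist x y := by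
  have key : ∀ (δ : G ≃g G) (a b : V), G.dist (δ a) (δ b) ≤ G.dist a b := by
    intro δ a b
    obtain ⟨w, hw⟩ := hG.exists_walk_length_eq_dist a b
    rw [← hw, ← SimpleGraph.Walk.length_map δ.toHom w]
    exact SimpleGraph.dist_le _
  refine le_antisymm (key γ x y) ?_
  simpa using key γ.symm (γ x) (γ y)

theorem mem_ball_iso (hG : G.Connected) (γ : G ≃g G) {x u : V} {n : ℕ} :
    γ u ∈ ball G (γ x) n ↔ u ∈ ball G x n := by
  simp [ball, dist_iso hG]

theorem ball_mono (x : V) : Monotone (ball G x) := fun _ _ h _ hu => le_trans hu h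

theorem mem_ball_comm {x u : V} {n : ℕ} : u ∈ ball G x n ↔ x ∈ ball G u n := by
  simp [ball, SimpleGraph.dist_comm]

theorem ball_finite (hG : IsUnimodularTransitive G) (x : V) (n : ℕ) : (ball G x n).Finite := by
  induction n with
  | zero =>
    refine (Set.finite_singleton x).subset fun u hu => ?_
    have : G.dist x u = 0 := Nat.le_zero.1 hu
    exact ((hG.connected.dist_eq_zero_iff).1 this).symm
  | succ n ih =>
    refine (ih.union (ih.biUnion fun w _ => hG.locallyFinite w)).subset fun u hu => ?_
    by_cases h : u ∈ ball G x n
    · exact Or.inl h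
    right
    have hd : G.dist u x = n + 1 := by
      rw [SimpleGraph.dist_comm]
      exact le_antisymm hu (Nat.lt_of_not_le h)
    obtain ⟨w, hw⟩ := hG.connected.exists_walk_length_eq_dist u x
    cases w with
    | nil => simp at hd
    | cons hadj p =>
      rename_i w
      simp only [SimpleGraph.Walk.length_cons] at hw
      refine Set.mem_biUnion (x := w) ?_ hadj.symm
      have := SimpleGraph.dist_le p
      rw [SimpleGraph.dist_comm] at this
      change G.dist x w ≤ n
      omega

theorem countable_vertices (hG : IsUnimodularTransitive G) : Countable V := by
  obtain ⟨o⟩ := hG.connected.nonempty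
  rw [← Set.countable_univ_iff]
  refine (Set.countable_iUnion fun n => (ball_finite hG o n).countable).mono
    fun u _ => Set.mem_iUnion.2 ⟨G.dist o u, le_refl (G.dist o u)⟩

/-- The number of centres `x'` whose `n`-ball meets the `n`-ball of `x` is finite, and the same for
all `x` by transitivity. -/
theorem exists_encard_meeting_balls (hG : IsUnimodularTransitive G) (n : ℕ) :
    ∃ K : ℕ, ∀ x, {x' | ¬ Disjoint (ball G x n) (ball G x' n)}.encard = K := by
  obtain ⟨o⟩ := hG.connected.nonempty
  have hfin : {x' | ¬ Disjoint (ball G o n) (ball G x' n)}.Finite := by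
    refine ((ball_finite hG o n).biUnion fun u _ => ball_finite hG u n).subset fun x' hx' => ?_
    obtain ⟨u, hu, hu'⟩ := Set.not_disjoint_iff.1 hx'
    exact Set.mem_biUnion hu (mem_ball_comm.1 hu')
  refine ⟨hfin.toFinset.card, fun x => ?_⟩
  rw [← hfin.encard_eq_coe_toFinset_card]
  obtain ⟨γ, rfl⟩ := hG.transitive o x
  refine Eq.trans ?_ (γ.injective.encard_image _)
  congr 1
  ext x'
  simp only [Set.not_disjoint_iff, Set.mem_ofPred_eq, Set.mem_image]
  constructor
  · rintro ⟨u, hu, hu'⟩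
    refine ⟨γ.symm x', ⟨γ.symm u, ?_, ?_⟩, by simp⟩
    · rw [← mem_ball_iso hG.connected γ]; simpa using hu
    · rw [← mem_ball_iso hG.connected γ]; simpa using hu'
  · rintro ⟨z, ⟨u, hu, hu'⟩, rfl⟩
    exact ⟨γ u, (mem_ball_iso hG.connected γ).2 hu, (mem_ball_iso hG.connected γ).2 hu'⟩

/-- The mass-transport principle. The vertices `x` and `v` are paired when some automorphism takes
`o` to `x` and `v` to `o`; this relation is symmetric, and unimodularity says that paired vertices
have equally many partners, so the mass sent from `o` to `v` can be spread evenly over the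
partners of `v`. -/
theorem mass_transport (hG : IsUnimodularTransitive G) (f : V → V → ℝ≥0∞)
    (hf : ∀ (γ : G ≃g G) x y, f (γ x) (γ y) = f x y) (o : V) :
    ∑' v, f o v = ∑' v, f v o := by
  classical
  let rel : V → V → Prop := fun x v => ∃ γ : G ≃g G, γ o = x ∧ γ v = o
  have rel_symm : ∀ {x v}, rel x v → rel v x := by
    rintro x v ⟨γ, rfl, h⟩
    exact ⟨γ.symm, by rw [← h]; simp, by simp⟩
  let m : V → ℕ∞ := fun v => {z | ∃ γ : G ≃g G, γ v = v ∧ γ o = z}.encard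
  have card_rel : ∀ v, {x | rel x v}.encard = m v := by
    intro v
    obtain ⟨γ₀, h₀⟩ := hG.transitive v o
    simp only [m]
    refine Eq.trans ?_ (γ₀.injective.encard_image _)
    congr 1
    ext x
    constructor
    · rintro ⟨γ, rfl, h⟩
      refine ⟨γ₀.symm (γ o), ⟨γ.trans γ₀.symm, ?_, rfl⟩, by simp⟩
      change γ₀.symm (γ v) = v
      rw [h, ← h₀]; simp
    · rintro ⟨z, ⟨δ, hδ, rfl⟩, rfl⟩
      refine ⟨δ.trans γ₀, rfl, ?_⟩
      change γ₀ (δ v) = o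
      rw [hδ, h₀]
  have m_rel : ∀ {x v}, rel x v → m x = m v := by
    rintro x v ⟨γ, rfl, h⟩
    simp only [m]
    rw [hG.unimodular v o]
    refine Eq.trans ?_ (γ.injective.encard_image _)
    congr 1
    ext z
    constructor
    · rintro ⟨δ, hδ, rfl⟩
      refine ⟨γ.symm (δ o), ⟨(γ.trans δ).trans γ.symm, ?_, ?_⟩, by simp⟩
      · change γ.symm (δ (γ o)) = o
        rw [hδ]; simp
      · change γ.symm (δ (γ v)) = _
        rw [h]
    · rintro ⟨z, ⟨δ, hδ, rfl⟩, rfl⟩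
      refine ⟨(γ.symm.trans δ).trans γ, ?_, ?_⟩
      · change γ (δ (γ.symm (γ o))) = γ o
        simp [hδ]
      · change γ (δ (γ.symm o)) = _
        rw [← h]; simp
  have m_ne_zero : ∀ v, (m v : ℝ≥0∞) ≠ 0 := by
    intro v
    have : m v ≠ 0 := by
      simp only [m, ne_eq, Set.encard_eq_zero]
      exact Set.Nonempty.ne_empty ⟨o, RelIso.refl _, rfl, rfl⟩
    simpa using this
  have m_ne_top : ∀ v, (m v : ℝ≥0∞) ≠ ⊤ := by
    intro v
    have : {z | ∃ γ : G ≃g G, γ v = v ∧ γ o = z}.Finite := by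
      refine (ball_finite hG v (G.dist v o)).subset ?_
      rintro z ⟨γ, hγ, rfl⟩
      have := dist_iso hG.connected γ v o
      rw [hγ] at this
      exact this.le
    have : m v ≠ ⊤ := Set.encard_ne_top_iff.2 this
    simpa using this
  have f_rel : ∀ {x v}, rel x v → f o v = f x o := by
    rintro x v ⟨γ, rfl, h⟩
    rw [← hf γ o v, h]
  have spread : ∀ (v : V) (c : ℝ≥0∞), (∑' x, if rel x v then c / m v else 0) = c := by
    intro v c
    have : (∑' x, if rel x v then c / (m v : ℝ≥0∞) else 0)
        = ∑' x, {x | rel x v}.indicator (fun _ => c / (m v : ℝ≥0∞)) x := by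
      simp [Set.indicator_apply]
    rw [this, ← tsum_subtype, ENNReal.tsum_set_const, card_rel]
    exact ENNReal.mul_div_cancel (m_ne_zero v) (m_ne_top v)
  calc ∑' v, f o v = ∑' v, ∑' x, if rel x v then f o v / m v else 0 := by simp_rw [spread]
    _ = ∑' x, ∑' v, if rel x v then f o v / m v else 0 := ENNReal.tsum_comm
    _ = ∑' x, ∑' v, if rel v x then f x o / m x else 0 := by
        refine tsum_congr fun x => tsum_congr fun v => ?_
        by_cases h : rel x v
        · rw [if_pos h, if_pos (rel_symm h), f_rel h, m_rel h]
        · rw [if_neg h, if_neg (mt rel_symm h)]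
    _ = ∑' x, f x o := by simp_rw [spread]

end Graph

/-! ### Paths -/

section Paths

variable {V : Type*} {G : SimpleGraph V}

/-- Paths are right-continuous step functions. -/
theorem Path.eq_right (y : Path G) (s : ℝ≥0) : ∃ b > s, ∀ r ∈ Set.Ico s b, y.1 r = y.1 s := by
  classical
  obtain ⟨t, v, h0, -, htop, hc, -⟩ := y.2
  have hex : ∃ i, s < t i := (htop.eventually (eventually_gt_atTop s)).exists
  have hi := Nat.find_spec hex
  have hpos : Nat.find hex ≠ 0 := by
    intro h
    rw [h, h0] at hi
    exact not_lt_bot hi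
  obtain ⟨j, hj⟩ := Nat.exists_eq_succ_of_ne_zero hpos
  have hle : t j ≤ s := not_lt.1 (Nat.find_min hex (by omega))
  rw [hj] at hi
  exact ⟨t (j + 1), hi, fun r hr => by
    rw [hc j r ⟨hle.trans hr.1, hr.2⟩, hc j s ⟨hle, hi⟩]⟩

/-- Paths have left limits. -/
theorem Path.eq_left (y : Path G) {s : ℝ≥0} (hs : 0 < s) :
    ∃ a < s, ∃ v, ∀ r ∈ Set.Ico a s, y.1 r = v := by
  classical
  obtain ⟨t, v, h0, -, htop, hc, -⟩ := y.2
  have hex : ∃ i, s ≤ t i := (htop.eventually (eventually_ge_atTop s)).exists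
  have hi := Nat.find_spec hex
  have hpos : Nat.find hex ≠ 0 := by
    intro h
    rw [h, h0] at hi
    exact absurd hs (not_lt.2 hi)
  obtain ⟨j, hj⟩ := Nat.exists_eq_succ_of_ne_zero hpos
  have hlt : t j < s := not_le.1 (Nat.find_min hex (by omega))
  rw [hj] at hi
  exact ⟨t j, hlt, v j, fun r hr => hc j r ⟨hr.1, hr.2.trans_le hi⟩⟩

/-- A path followed along a bounded monotone inner time eventually stays where it is. -/
theorem Path.eventually_eq_of_bounded (y : Path G) {τ : ℝ≥0 → ℝ≥0} (hτ : Monotone τ)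
    (hb : BddAbove (Set.range τ)) : ∃ v T, ∀ t ≥ T, y.1 (τ t) = v := by
  set L := ⨆ t, τ t
  have hle : ∀ t, τ t ≤ L := fun t => le_ciSup hb t
  by_cases hatt : ∃ T, τ T = L
  · obtain ⟨T, hT⟩ := hatt
    refine ⟨y.1 L, T, fun t ht => ?_⟩
    rw [le_antisymm (hle t) (hT ▸ hτ ht)]
  · push Not at hatt
    have hlt : ∀ t, τ t < L := fun t => lt_of_le_of_ne (hle t) (hatt t)
    obtain ⟨a, ha, v, hv⟩ := y.eq_left (lt_of_le_of_lt (zero_le (a := τ 0)) (hlt 0))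
    obtain ⟨T, hT⟩ := exists_lt_of_lt_ciSup ha
    exact ⟨v, T, fun t ht => hv _ ⟨hT.le.trans (hτ ht), hlt t⟩⟩

theorem measurableSet_path_eval (s : ℝ≥0) (v : V) : MeasurableSet {y : Path G | y.1 s = v} := by
  have : MeasurableSet[MeasurableSpace.comap (fun y : Path G => y.1 s) ⊤] {y : Path G | y.1 s = v} :=
    ⟨{v}, trivial, rfl⟩
  exact (le_iSup (fun s : ℝ≥0 => MeasurableSpace.comap (fun y : Path G => y.1 s) ⊤) s) _ this

theorem measurable_path_map (γ : G ≃g G) : Measurable (Path.map γ) := by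
  refine measurable_iff_comap_le.2 ?_
  rw [Path.measurableSpace, MeasurableSpace.comap_iSup]
  refine iSup_mono fun s => ?_
  rw [MeasurableSpace.comap_comp]
  rintro _ ⟨A, -, rfl⟩
  exact ⟨γ ⁻¹' A, trivial, rfl⟩

/-- The position of a random path at a random time is measurable: by right-continuity it is the
limit of the positions at the times `(⌊s k⌋ + 1) / k`. -/
theorem measurableSet_path_eval_random {Ω : Type*} [MeasurableSpace Ω] {Y : Ω → Path G}
    {s : Ω → ℝ≥0} (hY : Measurable Y) (hs : Measurable s) (v : V) :
    MeasurableSet {ω | (Y ω).1 (s ω) = v} := by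
  have heq : {ω | (Y ω).1 (s ω) = v} =
      {ω | ∀ᶠ k : ℕ in atTop, (Y ω).1 (((⌊s ω * (k + 1 : ℕ)⌋₊ + 1 : ℕ) : ℝ≥0) / (k + 1 : ℕ)) = v} := by
    ext ω
    simp only [Set.mem_ofPred_eq]
    obtain ⟨b, hb, hc⟩ := (Y ω).eq_right (s ω)
    have hev : ∀ᶠ k : ℕ in atTop,
        (Y ω).1 (((⌊s ω * (k + 1 : ℕ)⌋₊ + 1 : ℕ) : ℝ≥0) / (k + 1 : ℕ)) = (Y ω).1 (s ω) := by
      have hlim : Tendsto (fun k : ℕ => s ω + 1 / ((k : ℝ≥0) + 1)) atTop (nhds (s ω + 0)) :=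
        tendsto_const_nhds.add tendsto_one_div_add_atTop_nhds_zero_nat
      rw [add_zero] at hlim
      filter_upwards [hlim.eventually (gt_mem_nhds hb)] with k hk
      have hk0 : (0 : ℝ≥0) < (k + 1 : ℕ) := by positivity
      refine hc _ ⟨?_, lt_of_le_of_lt ?_ hk⟩
      · rw [le_div_iff₀ hk0]
        push_cast
        exact_mod_cast (Nat.lt_floor_add_one _).le
      · rw [div_le_iff₀ hk0, add_mul]
        push_cast
        rw [one_div, inv_mul_cancel₀ (by positivity)]
        gcongr
        exact_mod_cast Nat.floor_le (zero_le (a := s ω * ((k : ℝ≥0) + 1)))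
    constructor
    · intro h
      filter_upwards [hev] with k hk
      rw [hk, h]
    · intro h
      obtain ⟨k, h1, h2⟩ := (h.and hev).exists
      rw [← h2, h1]
  have hstep : ∀ k : ℕ, MeasurableSet
      {ω | (Y ω).1 (((⌊s ω * (k + 1 : ℕ)⌋₊ + 1 : ℕ) : ℝ≥0) / (k + 1 : ℕ)) = v} := by
    intro k
    have hfl : Measurable fun ω => ⌊s ω * (k + 1 : ℕ)⌋₊ := (hs.mul_const _).nat_floor
    have : {ω | (Y ω).1 (((⌊s ω * (k + 1 : ℕ)⌋₊ + 1 : ℕ) : ℝ≥0) / (k + 1 : ℕ)) = v} =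
        ⋃ j : ℕ, {ω | ⌊s ω * (k + 1 : ℕ)⌋₊ = j} ∩
          Y ⁻¹' {y | y.1 (((j + 1 : ℕ) : ℝ≥0) / (k + 1 : ℕ)) = v} := by
      ext ω
      simp
    rw [this]
    exact MeasurableSet.iUnion fun j =>
      (hfl (measurableSet_singleton j)).inter (hY (measurableSet_path_eval _ v))
  rw [heq]
  simp only [eventually_atTop]
  have hlim : {ω | ∃ n, ∀ k ≥ n,
      (Y ω).1 (((⌊s ω * (k + 1 : ℕ)⌋₊ + 1 : ℕ) : ℝ≥0) / (k + 1 : ℕ)) = v} =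
      ⋃ n : ℕ, ⋂ k : ℕ, ⋂ (_ : k ≥ n),
        {ω | (Y ω).1 (((⌊s ω * (k + 1 : ℕ)⌋₊ + 1 : ℕ) : ℝ≥0) / (k + 1 : ℕ)) = v} := by
    ext ω
    simp
  rw [hlim]
  exact MeasurableSet.iUnion fun n => MeasurableSet.iInter fun k => MeasurableSet.iInter fun _ =>
    hstep k

open Classical in
/-- The vertices seen by a path at the first `n + 1` elements of a fixed countable dense set of
times. -/
def sample (n : ℕ) (y : Path G) : Finset V :=
  (Finset.range (n + 1)).image fun k => y.1 (TopologicalSpace.denseSeq ℝ≥0 k)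

theorem mem_sample {n : ℕ} {y : Path G} {v : V} :
    v ∈ sample n y ↔ ∃ k < n + 1, y.1 (TopologicalSpace.denseSeq ℝ≥0 k) = v := by
  simp [sample]

theorem sample_nonempty (n : ℕ) (y : Path G) : (sample n y).Nonempty :=
  ⟨_, mem_sample.2 ⟨0, by omega, rfl⟩⟩

theorem sample_mono (y : Path G) : Monotone fun n => sample n y := by
  intro m n h v hv
  obtain ⟨k, hk, hv⟩ := mem_sample.1 hv
  exact mem_sample.2 ⟨k, by omega, hv⟩

theorem mem_range_of_mem_sample {n : ℕ} {y : Path G} {v : V} (h : v ∈ sample n y) :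
    v ∈ Set.range y.1 := by
  obtain ⟨k, -, hv⟩ := mem_sample.1 h
  exact ⟨_, hv⟩

theorem mem_sample_map (γ : G ≃g G) {n : ℕ} {y : Path G} {v : V} :
    γ v ∈ sample n (Path.map γ y) ↔ v ∈ sample n y := by
  have : ∀ s, (Path.map γ y).1 s = γ (y.1 s) := fun _ => rfl
  simp [mem_sample, this]

theorem sample_map_card (γ : G ≃g G) (n : ℕ) (y : Path G) :
    (sample n (Path.map γ y)).card = (sample n y).card := by
  refine (Finset.card_bij (fun v _ => γ v) (fun v hv => (mem_sample_map γ).2 hv)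
    (fun a _ b _ h => γ.injective h) fun b hb => ⟨γ.symm b, ?_, by simp⟩).symm
  rw [← mem_sample_map γ]
  simpa using hb

theorem exists_mem_sample {y : Path G} {v : V} (h : v ∈ Set.range y.1) :
    ∃ n, v ∈ sample n y := by
  obtain ⟨s, rfl⟩ := h
  obtain ⟨b, hb, hc⟩ := y.eq_right s
  obtain ⟨q, ⟨k, rfl⟩, hq⟩ := (TopologicalSpace.denseRange_denseSeq ℝ≥0).exists_between hb
  exact ⟨k, mem_sample.2 ⟨k, by omega, hc _ ⟨hq.1.le, hq.2⟩⟩⟩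

/-- The samples of a path with infinite range grow without bound. -/
theorem tendsto_sample_card {y : Path G} (hy : (Set.range y.1).Infinite) :
    Tendsto (fun n => (sample n y).card) atTop atTop := by
  refine tendsto_atTop_atTop_of_monotone (fun m n h => Finset.card_le_card (sample_mono y h))
    fun N => ?_
  obtain ⟨A, hA, hN⟩ := hy.exists_subset_card_eq N
  have : ∀ v : V, ∃ n, v ∈ A → v ∈ sample n y := by
    intro v
    by_cases hv : v ∈ A
    · obtain ⟨n, hn⟩ := exists_mem_sample (hA hv)
      exact ⟨n, fun _ => hn⟩
    · exact ⟨0, fun h => absurd h hv⟩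
  choose n hn using this
  refine ⟨A.sup n, hN ▸ Finset.card_le_card fun v hv => ?_⟩
  exact sample_mono y (Finset.le_sup (f := n) hv) (hn v hv)

theorem measurableSet_mem_sample (n : ℕ) (v : V) : MeasurableSet {y : Path G | v ∈ sample n y} := by
  have : {y : Path G | v ∈ sample n y} = ⋃ k : ℕ, ⋃ (_ : k < n + 1),
      {y : Path G | y.1 (TopologicalSpace.denseSeq ℝ≥0 k) = v} := by
    ext y
    simp [mem_sample]
  rw [this]
  exact MeasurableSet.iUnion fun k => MeasurableSet.iUnion fun _ => measurableSet_path_eval _ _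

/-- The probability of `v` under the uniform distribution on the sample `sample n y`. -/
def weight (n : ℕ) (y : Path G) (v : V) : ℝ≥0∞ :=
  Set.indicator {y : Path G | v ∈ sample n y} (fun y => ((sample n y).card : ℝ≥0∞)⁻¹) y

theorem weight_le_one (n : ℕ) (y : Path G) (v : V) : weight n y v ≤ 1 := by
  refine Set.indicator_apply_le' (fun _ => ?_) fun _ => zero_le_one
  rw [ENNReal.inv_le_one]
  exact_mod_cast (sample_nonempty n y).card_pos

theorem weight_map (γ : G ≃g G) (n : ℕ) (y : Path G) (v : V) :
    weight n (Path.map γ y) (γ v) = weight n y v := by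
  have : Path.map γ y ∈ {y : Path G | γ v ∈ sample n y} ↔ y ∈ {y : Path G | v ∈ sample n y} :=
    mem_sample_map γ
  unfold weight
  by_cases h : y ∈ {y : Path G | v ∈ sample n y}
  · rw [Set.indicator_of_mem h, Set.indicator_of_mem (this.2 h), sample_map_card]
  · rw [Set.indicator_of_notMem h, Set.indicator_of_notMem (mt this.1 h)]

theorem weight_eq_zero {n : ℕ} {y : Path G} {v : V} (h : v ∉ Set.range y.1) :
    weight n y v = 0 :=
  Set.indicator_of_notMem
    (show y ∉ {y : Path G | v ∈ sample n y} from fun h' => h (mem_range_of_mem_sample h')) _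

theorem tsum_mem_sample (n : ℕ) (y : Path G) (c : ℝ≥0∞) :
    ∑' v, Set.indicator {y : Path G | v ∈ sample n y} (fun _ => c) y = (sample n y).card * c := by
  rw [tsum_eq_sum (s := sample n y) fun v hv =>
    Set.indicator_of_notMem (show y ∉ {y : Path G | v ∈ sample n y} from hv) _]
  rw [Finset.sum_congr rfl fun v hv =>
    Set.indicator_of_mem (show y ∈ {y : Path G | v ∈ sample n y} from hv) _]
  simp

theorem tsum_weight (n : ℕ) (y : Path G) : ∑' v, weight n y v = 1 := by
  have := tsum_mem_sample n y ((sample n y).card : ℝ≥0∞)⁻¹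
  rw [ENNReal.mul_inv_cancel (by exact_mod_cast (sample_nonempty n y).card_pos.ne')
    (by simp)] at this
  rw [← this]
  rfl

theorem measurable_weight [Countable V] (n : ℕ) (v : V) :
    Measurable fun y : Path G => weight n y v := by
  have hcard : Measurable fun y : Path G => ((sample n y).card : ℝ≥0∞) := by
    have : (fun y : Path G => ((sample n y).card : ℝ≥0∞)) =
        fun y => ∑' v, {y : Path G | v ∈ sample n y}.indicator (fun _ => (1 : ℝ≥0∞)) y := by
      funext y
      rw [tsum_mem_sample, mul_one]
    rw [this]
    exact Measurable.tsum fun v => measurable_const.indicator (measurableSet_mem_sample n v)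
  exact hcard.inv.indicator (measurableSet_mem_sample n v)

theorem tendsto_weight {y : Path G} (hy : (Set.range y.1).Infinite) (v : V) :
    Tendsto (fun n => weight n y v) atTop (nhds 0) := by
  have h : Tendsto (fun n => ((sample n y).card : ℝ≥0∞)⁻¹) atTop (nhds 0) :=
    ENNReal.tendsto_inv_nat_nhds_zero.comp (tendsto_sample_card hy)
  refine tendsto_of_tendsto_of_tendsto_of_le_of_le tendsto_const_nhds h (fun _ => zero_le) ?_
  exact fun n => Set.indicator_apply_le' (fun _ => le_rfl) fun _ => zero_le

end Paths

/-! ### The random input: invariance and independence -/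

/-- Apply the map `φ` to all coordinates and permute them by `e`: this preserves a product measure
whose factors are permuted in the same way. -/
theorem measurePreserving_infinitePi_reindex {ι X : Type*} [MeasurableSpace X]
    (μ : ι → Measure X) [∀ i, IsProbabilityMeasure (μ i)] (e : ι ≃ ι) {φ : X → X}
    (hφ : Measurable φ) (h : ∀ i, (μ i).map φ = μ (e i)) :
    MeasurePreserving (fun (ω : ι → X) j => φ (ω (e.symm j)))
      (Measure.infinitePi μ) (Measure.infinitePi μ) := by
  classical
  have hmeas : Measurable (fun (ω : ι → X) j => φ (ω (e.symm j))) :=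
    measurable_pi_lambda _ fun j => hφ.comp (measurable_pi_apply _)
  refine ⟨hmeas, Measure.eq_infinitePi μ fun s t ht => ?_⟩
  rw [Measure.map_apply hmeas (MeasurableSet.pi s.countable_toSet fun i _ => ht i)]
  have : (fun (ω : ι → X) j => φ (ω (e.symm j))) ⁻¹' (Set.pi s t) =
      Set.pi (s.map e.symm.toEmbedding) fun i => φ ⁻¹' t (e i) := by
    ext ω
    simp only [Set.mem_preimage, Set.mem_pi, Finset.mem_coe, Finset.mem_map_equiv, Equiv.symm_symm]
    exact ⟨fun h i hi => by simpa using h (e i) hi, fun h i hi => by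
      simpa using h (e.symm i) (by simpa using hi)⟩
  rw [this, Measure.infinitePi_pi μ fun i _ => hφ (ht _), Finset.prod_map]
  refine Finset.prod_congr rfl fun i _ => ?_
  rw [← Measure.map_apply hφ (ht _), h]
  simp

section Law

variable {V S : Type*} {G : SimpleGraph V}

/-- The image of an input under an automorphism. -/
def Input.map (γ : G ≃g G) (ω : Input G S) : Input G S :=
  (fun v => ω.1 (γ.symm v),
    fun p => (Path.map γ (ω.2 (γ.symm p.1, p.2)).1, (ω.2 (γ.symm p.1, p.2)).2))

theorem Input.map_symm_map (γ : G ≃g G) (ω : Input G S) : Input.map γ.symm (Input.map γ ω) = ω := by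
  have hp : ∀ y : Path G, Path.map γ.symm (Path.map γ y) = y := fun y =>
    Subtype.ext (funext fun s => γ.symm_apply_apply (y.1 s))
  have hv : ∀ v, γ.symm (γ.symm.symm v) = v := fun v => γ.symm_apply_apply v
  refine Prod.ext (funext fun v => ?_) (funext fun p => Prod.ext ?_ ?_)
  · simp only [Input.map, hv]
  · simp only [Input.map, hv, hp]
  · simp only [Input.map, hv]

variable [MeasurableSpace S] (μ : ProbabilityMeasure ℕ)
  (ν : V → ProbabilityMeasure (Path G)) (ρ : ProbabilityMeasure S)

instance : IsProbabilityMeasure (inputLaw μ ν ρ) := by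
  unfold inputLaw
  infer_instance

variable {ν}

theorem measurePreserving_input_map (hν : IsInvariantPathLaw ν) (γ : G ≃g G) :
    MeasurePreserving (Input.map γ) (inputLaw μ ν ρ) (inputLaw μ ν ρ) := by
  have h1 := measurePreserving_infinitePi_reindex (fun _ : V => (μ : Measure ℕ)) γ.toEquiv
    measurable_id fun _ => Measure.map_id
  have h2 := measurePreserving_infinitePi_reindex
    (fun p : V × ℕ => (ν p.1 : Measure (Path G)).prod (ρ : Measure S))
    (γ.toEquiv.prodCongr (Equiv.refl ℕ)) (φ := Prod.map (Path.map γ) id)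
    ((measurable_path_map γ).prodMap measurable_id) (fun p => by
      rw [← Measure.map_prod_map _ _ (measurable_path_map γ) measurable_id, hν.invariant,
        Measure.map_id]
      rfl)
  exact h1.prod h2

theorem ae_path (ρ : ProbabilityMeasure S) (p : V × ℕ) {P : Path G → Prop}
    (hP : ∀ᵐ y ∂(ν p.1 : Measure (Path G)), P y) :
    ∀ᵐ ω ∂inputLaw μ ν ρ, P (ω.2 p).1 := by
  have h1 : ∀ᵐ z ∂(ν p.1 : Measure (Path G)).prod (ρ : Measure S), P z.1 :=
    Measure.quasiMeasurePreserving_fst.ae hP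
  have h2 := (measurePreserving_eval_infinitePi
    (fun p : V × ℕ => (ν p.1 : Measure (Path G)).prod (ρ : Measure S)) p).quasiMeasurePreserving.ae h1
  exact (Measure.quasiMeasurePreserving_snd (μ := Measure.infinitePi fun _ : V => (μ : Measure ℕ))).ae
    h2

theorem lintegral_number (ν : V → ProbabilityMeasure (Path G)) (v : V) :
    ∫⁻ ω, (ω.1 v : ℝ≥0∞) ∂inputLaw μ ν ρ = meanDensity μ := by
  have h1 := measurePreserving_eval_infinitePi (fun _ : V => (μ : Measure ℕ)) v
  have h2 : MeasurePreserving Prod.fst (inputLaw μ ν ρ)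
      (Measure.infinitePi fun _ : V => (μ : Measure ℕ)) := measurePreserving_fst
  exact (h1.comp h2).lintegral_comp (f := fun n : ℕ => (n : ℝ≥0∞)) (measurable_of_countable _)

/-- The σ-algebra of a single coordinate of the input: the number of particles at a vertex, or the
putative path and the mark of a particle. -/
@[reducible] def coordAlgebra (G : SimpleGraph V) (S : Type*) [MeasurableSpace S] :
    V ⊕ V × ℕ → MeasurableSpace (Input G S)
  | .inl v => MeasurableSpace.comap (fun ω => ω.1 v) inferInstance
  | .inr p => MeasurableSpace.comap (fun ω => ω.2 p) inferInstance

/-- The σ-algebra of the part of the input that belongs to the vertices in `B`. -/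
@[reducible] def localAlgebra (G : SimpleGraph V) (S : Type*) [MeasurableSpace S] (B : Set V) :
    MeasurableSpace (Input G S) :=
  ⨆ j ∈ {j : V ⊕ V × ℕ | Sum.elim id Prod.fst j ∈ B}, coordAlgebra G S j

theorem coordAlgebra_le (j : V ⊕ V × ℕ) :
    coordAlgebra G S j ≤ (inferInstance : MeasurableSpace (Input G S)) := by
  cases j with
  | inl v => exact ((measurable_pi_apply v).comp measurable_fst).comap_le
  | inr p => exact ((measurable_pi_apply p).comp measurable_snd).comap_le

theorem localAlgebra_le (B : Set V) :
    localAlgebra G S B ≤ (inferInstance : MeasurableSpace (Input G S)) :=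
  iSup₂_le fun j _ => coordAlgebra_le j

theorem coordAlgebra_le_localAlgebra {j : V ⊕ V × ℕ} {B : Set V}
    (h : Sum.elim id Prod.fst j ∈ B) : coordAlgebra G S j ≤ localAlgebra G S B :=
  le_iSup₂_of_le (f := fun (j : V ⊕ V × ℕ)
    (_ : j ∈ {j : V ⊕ V × ℕ | Sum.elim id Prod.fst j ∈ B}) => coordAlgebra G S j) j h le_rfl

theorem localAlgebra_mono : Monotone (localAlgebra G S) := fun _ _ h =>
  iSup₂_le fun _ hj => coordAlgebra_le_localAlgebra (h hj)

theorem measurable_path_localAlgebra {B : Set V} {p : V × ℕ} (h : p.1 ∈ B) :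
    Measurable[localAlgebra G S B] fun ω : Input G S => (ω.2 p).1 := by
  have : Measurable[localAlgebra G S B] fun ω : Input G S => ω.2 p :=
    Measurable.of_comap_le (coordAlgebra_le_localAlgebra (j := .inr p) h)
  exact measurable_fst.comp this

variable (ν)

theorem iIndep_coordAlgebra : iIndep (coordAlgebra G S) (inputLaw μ ν ρ) := by
  classical
  rw [iIndep_iff]
  intro s f hf
  have hL : ∀ v, ∃ A : Set ℕ, MeasurableSet A ∧
      (Sum.inl v ∈ s → (fun ω : Input G S => ω.1 v) ⁻¹' A = f (.inl v)) := by
    intro v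
    by_cases hv : Sum.inl v ∈ s
    · obtain ⟨A, hA, h⟩ := hf _ hv
      exact ⟨A, hA, fun _ => h⟩
    · exact ⟨∅, MeasurableSet.empty, fun h => absurd h hv⟩
  have hR : ∀ p, ∃ A : Set (Path G × S), MeasurableSet A ∧
      (Sum.inr p ∈ s → (fun ω : Input G S => ω.2 p) ⁻¹' A = f (.inr p)) := by
    intro p
    by_cases hp : Sum.inr p ∈ s
    · obtain ⟨A, hA, h⟩ := hf _ hp
      exact ⟨A, hA, fun _ => h⟩
    · exact ⟨∅, MeasurableSet.empty, fun h => absurd h hp⟩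
  choose A hA hAf using hL
  choose B hB hBf using hR
  have hinter : (⋂ j ∈ s, f j) = (Set.pi s.toLeft A) ×ˢ (Set.pi s.toRight B) := by
    ext ω
    simp only [Set.mem_iInter, Set.mem_prod, Set.mem_pi, Finset.mem_coe, Finset.mem_toLeft,
      Finset.mem_toRight]
    constructor
    · intro h
      exact ⟨fun v hv => by have := h _ hv; rwa [← hAf v hv] at this,
        fun p hp => by have := h _ hp; rwa [← hBf p hp] at this⟩
    · rintro ⟨h1, h2⟩ (v | p) hj
      · rw [← hAf v hj]; exact h1 v hj
      · rw [← hBf p hj]; exact h2 p hj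
  have hl : ∀ v, inputLaw μ ν ρ ((fun ω : Input G S => ω.1 v) ⁻¹' A v) = (μ : Measure ℕ) (A v) := by
    intro v
    have h1 := measurePreserving_eval_infinitePi (fun _ : V => (μ : Measure ℕ)) v
    have h2 : MeasurePreserving Prod.fst (inputLaw μ ν ρ)
        (Measure.infinitePi fun _ : V => (μ : Measure ℕ)) := measurePreserving_fst
    exact (h1.comp h2).measure_preimage (hA v).nullMeasurableSet
  have hr : ∀ p, inputLaw μ ν ρ ((fun ω : Input G S => ω.2 p) ⁻¹' B p) =
      (ν p.1 : Measure (Path G)).prod (ρ : Measure S) (B p) := by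
    intro p
    have h1 := measurePreserving_eval_infinitePi
      (fun p : V × ℕ => (ν p.1 : Measure (Path G)).prod (ρ : Measure S)) p
    have h2 : MeasurePreserving Prod.snd (inputLaw μ ν ρ) (Measure.infinitePi
        fun p : V × ℕ => (ν p.1 : Measure (Path G)).prod (ρ : Measure S)) := measurePreserving_snd
    exact (h1.comp h2).measure_preimage (hB p).nullMeasurableSet
  rw [hinter, ← s.toLeft_disjSum_toRight, Finset.prod_disjSum, s.toLeft_disjSum_toRight]
  rw [inputLaw, Measure.prod_prod, Measure.infinitePi_pi _ fun v _ => hA v,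
    Measure.infinitePi_pi _ fun p _ => hB p, ← inputLaw]
  congr 1
  · exact Finset.prod_congr rfl fun v hv => by
      rw [← hAf v (Finset.mem_toLeft.1 hv), hl]
  · exact Finset.prod_congr rfl fun p hp => by
      rw [← hBf p (Finset.mem_toRight.1 hp), hr]

theorem indep_localAlgebra {B B' : Set V} (h : Disjoint B B') :
    Indep (localAlgebra G S B) (localAlgebra G S B') (inputLaw μ ν ρ) := by
  refine indep_iSup_of_disjoint coordAlgebra_le (iIndep_coordAlgebra μ ν ρ) ?_
  exact Set.disjoint_left.2 fun j hj hj' => Set.disjoint_left.1 h hj hj'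

variable (S) in
/-- The input belonging to larger and larger balls around `x`. -/
def ballFiltration (G : SimpleGraph V) (x : V) :
    Filtration ℕ (inferInstance : MeasurableSpace (Input G S)) where
  seq n := localAlgebra G S (ball G x n)
  mono' _ _ h := localAlgebra_mono (ball_mono x h)
  le' _ := localAlgebra_le _

theorem iSup_ballFiltration (x : V) :
    ⨆ n, ballFiltration S G x n = (inferInstance : MeasurableSpace (Input G S)) := by
  refine le_antisymm (iSup_le fun n => (ballFiltration S G x).le n) ?_
  have key : ∀ j, coordAlgebra G S j ≤ ⨆ n, ballFiltration S G x n := fun j =>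
    le_iSup_of_le (G.dist x (Sum.elim id Prod.fst j))
      (coordAlgebra_le_localAlgebra (le_refl (G.dist x _)))
  refine sup_le ?_ ?_
  · refine le_trans (le_of_eq (MeasurableSpace.comap_iSup)) (iSup_le fun v => ?_)
    rw [MeasurableSpace.comap_comp]
    exact key (.inl v)
  · refine le_trans (le_of_eq (MeasurableSpace.comap_iSup)) (iSup_le fun p => ?_)
    rw [MeasurableSpace.comap_comp]
    exact key (.inr p)

theorem measurable_input_map_ballFiltration (hG : G.Connected) (γ : G ≃g G) (x : V) (n : ℕ) :
    Measurable[ballFiltration S G x n, ballFiltration S G (γ x) n]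
      (Input.map γ : Input G S → Input G S) := by
  refine measurable_iff_comap_le.2 ?_
  change MeasurableSpace.comap _ (⨆ j ∈ _, coordAlgebra G S j) ≤ _
  simp only [MeasurableSpace.comap_iSup]
  refine iSup₂_le fun j hj => ?_
  have hmem : ∀ v, v ∈ ball G (γ x) n → γ.symm v ∈ ball G x n := fun v hv => by
    rw [← mem_ball_iso hG γ]; simpa using hv
  cases j with
  | inl v =>
    change MeasurableSpace.comap _ (MeasurableSpace.comap _ _) ≤ _
    rw [MeasurableSpace.comap_comp]
    exact coordAlgebra_le_localAlgebra (j := .inl (γ.symm v)) (hmem v hj)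
  | inr p =>
    change MeasurableSpace.comap _ (MeasurableSpace.comap _ _) ≤ _
    rw [MeasurableSpace.comap_comp]
    refine le_trans ?_
      (coordAlgebra_le_localAlgebra (j := .inr (γ.symm p.1, p.2)) (hmem p.1 hj))
    have hm : Measurable (Prod.map (Path.map γ) (id : S → S)) :=
      (measurable_path_map γ).prodMap measurable_id
    refine le_trans (le_of_eq ?_) (MeasurableSpace.comap_mono hm.comap_le)
    rw [MeasurableSpace.comap_comp]
    rfl

variable {ν}

/-- Conditional expectations given the input in a ball are equivariant. -/
theorem condExp_input_map (hG : G.Connected) (hν : IsInvariantPathLaw ν) (γ : G ≃g G) (x : V)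
    (n : ℕ) {f f' : Input G S → ℝ} (hf : Integrable f (inputLaw μ ν ρ))
    (hf' : Integrable f' (inputLaw μ ν ρ))
    (hff : (fun ω => f' (Input.map γ ω)) =ᵐ[inputLaw μ ν ρ] f) :
    (fun ω => (inputLaw μ ν ρ)[f' | ballFiltration S G (γ x) n] (Input.map γ ω))
      =ᵐ[inputLaw μ ν ρ] (inputLaw μ ν ρ)[f | ballFiltration S G x n] := by
  have hθ := measurePreserving_input_map (S := S) μ ρ hν γ
  refine ae_eq_condExp_of_forall_setIntegral_eq ((ballFiltration S G x).le n) hf ?_ ?_ ?_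
  · intro s _ _
    exact (hθ.integrable_comp_of_integrable integrable_condExp).integrableOn
  · intro s hs _
    set s' := Input.map γ.symm ⁻¹' s with hs'
    have hs'm : MeasurableSet[ballFiltration S G (γ x) n] s' := by
      have := measurable_input_map_ballFiltration (S := S) hG γ.symm (γ x) n
      rw [γ.symm_apply_apply] at this
      exact this hs
    have hpre : Input.map γ ⁻¹' s' = s := by
      rw [hs', ← Set.preimage_comp]
      convert Set.preimage_id
      funext ω
      exact Input.map_symm_map γ ω
    have hs'm0 : MeasurableSet s' := (ballFiltration S G (γ x)).le n _ hs'm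
    have hchange : ∀ {g : Input G S → ℝ}, Integrable g (inputLaw μ ν ρ) →
        ∫ ω in s, g (Input.map γ ω) ∂inputLaw μ ν ρ = ∫ ω in s', g ω ∂inputLaw μ ν ρ := by
      intro g hg
      rw [← hpre]
      conv_rhs => rw [← hθ.map_eq]
      exact (setIntegral_map hs'm0 (by rw [hθ.map_eq]; exact hg.aestronglyMeasurable)
        hθ.measurable.aemeasurable).symm
    rw [hchange integrable_condExp, setIntegral_condExp ((ballFiltration S G (γ x)).le n) hf' hs'm,
      ← hchange hf']
    exact setIntegral_congr_ae ((ballFiltration S G x).le n _ hs) (hff.mono fun _ h _ => h)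
  · exact (stronglyMeasurable_condExp.comp_measurable
      (measurable_input_map_ballFiltration hG γ x n)).aestronglyMeasurable

end Law

/-! ### The dynamics -/

section Dynamics

variable {V S : Type*} {G : SimpleGraph V}

theorem present_input_map (γ : G ≃g G) {ω : Input G S} {p : V × ℕ} :
    Present (Input.map γ ω) p ↔ Present ω (γ.symm p.1, p.2) := Iff.rfl

theorem position_input_map (γ : G ≃g G) (ω : Input G S) (τ : V × ℕ → ℝ≥0 → ℝ≥0) (p : V × ℕ)
    (t : ℝ≥0) : position (Input.map γ ω) (fun q => τ (γ.symm q.1, q.2)) p t =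
      γ (position ω τ (γ.symm p.1, p.2) t) := rfl

theorem historyUpTo_input_map (γ : G ≃g G) (ω : Input G S) (τ : V × ℕ → ℝ≥0 → ℝ≥0) (t : ℝ≥0) :
    historyUpTo (Input.map γ ω) (fun q => τ (γ.symm q.1, q.2)) t =
      History.map γ (historyUpTo ω τ t) := by
  funext p
  by_cases h : Present ω (γ.symm p.1, p.2)
  · have h' : Present (Input.map γ ω) p := h
    simp only [historyUpTo, History.map, if_pos h, if_pos h']
    rfl
  · have h' : ¬ Present (Input.map γ ω) p := h
    simp only [historyUpTo, History.map, if_neg h, if_neg h', Option.map_none]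

theorem rate_input_map {R : Rule V S} (hR : Rule.IsInvariant G R) (γ : G ≃g G) (ω : Input G S)
    (τ : V × ℕ → ℝ≥0 → ℝ≥0) (p : V × ℕ) (t : ℝ≥0) :
    rate R (Input.map γ ω) (fun q => τ (γ.symm q.1, q.2)) p t =
      rate R ω τ (γ.symm p.1, p.2) t := by
  have := hR γ (γ.symm p.1, p.2) t (historyUpTo ω τ t)
  rw [γ.apply_symm_apply] at this
  rw [rate, historyUpTo_input_map, rate, ← this]

theorem isSolution_input_map {R : Rule V S} (hR : Rule.IsInvariant G R) (γ : G ≃g G)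
    {ω : Input G S} {τ : V × ℕ → ℝ≥0 → ℝ≥0} (h : IsSolution R ω τ) :
    IsSolution R (Input.map γ ω) (fun q => τ (γ.symm q.1, q.2)) := by
  intro p hp t
  simp only [rate_input_map hR]
  exact h (γ.symm p.1, p.2) hp t

theorem isLocal_input_map (γ : G ≃g G) {ω : Input G S} {τ : V × ℕ → ℝ≥0 → ℝ≥0}
    (h : IsLocal ω τ) : IsLocal (Input.map γ ω) (fun q => τ (γ.symm q.1, q.2)) := by
  intro v T
  refine ((h (γ.symm v) T).image fun q => (γ q.1, q.2)).subset ?_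
  rintro p ⟨hp, t, ht, hv⟩
  refine ⟨(γ.symm p.1, p.2), ⟨hp, t, ht, ?_⟩, by simp⟩
  rw [position_input_map] at hv
  rw [← hv, γ.symm_apply_apply]

/-- Uniqueness of the local solution makes the process equivariant. -/
theorem IsRealization.ae_input_map [MeasurableSpace S] {R : Rule V S} {μ : ProbabilityMeasure ℕ}
    {ν : V → ProbabilityMeasure (Path G)} {ρ : ProbabilityMeasure S}
    {Φ : Input G S → V × ℕ → ℝ≥0 → ℝ≥0} (hΦ : IsRealization R μ ν ρ Φ)
    (hν : IsInvariantPathLaw ν) (hR : Rule.IsInvariant G R) (γ : G ≃g G) :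
    ∀ᵐ ω ∂inputLaw μ ν ρ, ∀ p, Present ω p → Φ (Input.map γ ω) (γ p.1, p.2) = Φ ω p := by
  filter_upwards [hΦ.solution, hΦ.isLocal,
    (measurePreserving_input_map μ ρ hν γ).quasiMeasurePreserving.ae hΦ.unique] with ω hs hl hu
  intro p hp
  have := hu _ (isSolution_input_map hR γ hs) (isLocal_input_map γ hl) (γ p.1, p.2)
    (by rw [present_input_map]; simpa using hp)
  rw [← this]
  simp

variable {R : Rule V S} {ω : Input G S} {τ : V × ℕ → ℝ≥0 → ℝ≥0} {p : V × ℕ}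

theorem IsSolution.sub_eq (h : IsSolution R ω τ) (hp : Present ω p) (s t : ℝ≥0) :
    (τ p t : ℝ) - τ p s = ∫ u in (s : ℝ)..t, (rate R ω τ p u.toNNReal : ℝ) := by
  rw [(h p hp t).2, (h p hp s).2]
  exact intervalIntegral.integral_interval_sub_left (h p hp t).1 (h p hp s).1

theorem IsSolution.monotone (h : IsSolution R ω τ) (hp : Present ω p) : Monotone (τ p) := by
  intro s t hst
  have h1 := h.sub_eq hp s t
  have h2 : 0 ≤ ∫ u in (s : ℝ)..t, (rate R ω τ p u.toNNReal : ℝ) :=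
    intervalIntegral.integral_nonneg (by exact_mod_cast hst) fun u _ => NNReal.coe_nonneg _
  rw [← NNReal.coe_le_coe]
  linarith

/-- Inner times are continuous and start at `0`, so they take all intermediate values. -/
theorem IsSolution.exists_eq (h : IsSolution R ω τ) (hp : Present ω p) {s T : ℝ≥0}
    (hs : s ≤ τ p T) : ∃ t ≤ T, τ p t = s := by
  have hint := (h p hp T).1
  have hcont := intervalIntegral.continuousOn_primitive_interval' hint Set.left_mem_uIcc
  rw [Set.uIcc_of_le T.coe_nonneg] at hcont
  have hmem : (s : ℝ) ∈ Set.Icc (∫ u in (0 : ℝ)..0, (rate R ω τ p u.toNNReal : ℝ))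
      (∫ u in (0 : ℝ)..T, (rate R ω τ p u.toNNReal : ℝ)) := by
    rw [intervalIntegral.integral_same, ← (h p hp T).2]
    exact ⟨s.coe_nonneg, by exact_mod_cast hs⟩
  obtain ⟨t, ht, hts⟩ := intermediate_value_Icc T.coe_nonneg hcont hmem
  refine ⟨⟨t, ht.1⟩, ht.2, ?_⟩
  rw [← NNReal.coe_inj, (h p hp ⟨t, ht.1⟩).2]
  exact hts

/-- The inner time of the particle `p` grows without bound. -/
def Endless (τ : V × ℕ → ℝ≥0 → ℝ≥0) (p : V × ℕ) : Prop := ∀ n : ℕ, ∃ m : ℕ, (n : ℝ≥0) ≤ τ p m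

/-- Only finitely many endless particles visit a vertex without activity after time `T`: a first
visit after time `T` would last forever. -/
theorem finite_endless_visitors (h : IsSolution R ω τ) (hl : IsLocal ω τ) {v : V} {T : ℝ≥0}
    (hT : ∀ t > T, ∀ p, position ω τ p t = v → ¬ Active R ω τ p t) :
    {p | Present ω p ∧ Endless τ p ∧ v ∈ Set.range (ω.2 p).1.1}.Finite := by
  refine (hl v T).subset ?_
  rintro p ⟨hp, hend, s, hs⟩
  refine ⟨hp, ?_⟩
  by_contra! hno
  obtain ⟨b, hb, hc⟩ := (ω.2 p).1.eq_right s
  obtain ⟨c, hsc, hcb⟩ := exists_between hb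
  obtain ⟨n, hn⟩ := exists_nat_ge c
  obtain ⟨m, hm⟩ := hend n
  obtain ⟨t₁, -, ht₁⟩ := h.exists_eq hp (hn.trans hm)
  obtain ⟨t, htt, ht⟩ := h.exists_eq hp (hsc.le.trans ht₁.ge)
  have hrate : ∀ u : ℝ≥0, t ≤ u → u ≤ t₁ → rate R ω τ p u = 0 := by
    intro u htu hut
    have hpos : position ω τ p u = v := by
      rw [position, hc _ ⟨ht ▸ h.monotone hp htu, lt_of_le_of_lt (h.monotone hp hut) (ht₁ ▸ hcb)⟩, hs]
    have hTu : u > T := by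
      by_contra hle
      exact hno u (not_lt.1 hle) hpos
    by_contra hne
    exact hT u hTu p hpos ⟨hp, pos_iff_ne_zero.2 hne⟩
  have h1 := h.sub_eq hp t t₁
  have h2 : ∫ u in (t : ℝ)..t₁, (rate R ω τ p u.toNNReal : ℝ) = ∫ u in (t : ℝ)..t₁, (0 : ℝ) := by
    refine intervalIntegral.integral_congr fun u hu => ?_
    rw [Set.uIcc_of_le (by exact_mod_cast htt)] at hu
    have := hrate u.toNNReal (NNReal.le_toNNReal_of_coe_le hu.1)
      (Real.toNNReal_le_iff_le_coe.2 hu.2)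
    simp [this]
  rw [h2, intervalIntegral.integral_zero, ht₁, ht] at h1
  have : (s : ℝ) < c := by exact_mod_cast hsc
  linarith

theorem IsSolution.exists_position_eq (h : IsSolution R ω τ) (hp : Present ω p)
    (hend : ¬ Endless τ p) : ∃ v T, ∀ t ≥ T, position ω τ p t = v := by
  refine (ω.2 p).1.eventually_eq_of_bounded (h.monotone hp) ?_
  unfold Endless at hend
  push Not at hend
  obtain ⟨n, hn⟩ := hend
  refine ⟨n, ?_⟩
  rintro _ ⟨t, rfl⟩
  obtain ⟨m, hm⟩ := exists_nat_ge t
  exact (h.monotone hp hm).trans (hn m).le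

end Dynamics

section Events

variable {V S : Type*} {G : SimpleGraph V} [MeasurableSpace S] {R : Rule V S}
  {μ : ProbabilityMeasure ℕ} {ν : V → ProbabilityMeasure (Path G)} {ρ : ProbabilityMeasure S}
  {Φ : Input G S → V × ℕ → ℝ≥0 → ℝ≥0}

theorem measurableSet_present (p : V × ℕ) : MeasurableSet {ω : Input G S | Present ω p} :=
  ((measurable_pi_apply p.1).comp measurable_fst) (measurableSet_Ioi (a := p.2))

/-- The event that the particle `p` exists and has unbounded inner time. -/
def endlessEvent (Φ : Input G S → V × ℕ → ℝ≥0 → ℝ≥0) (p : V × ℕ) : Set (Input G S) :=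
  {ω | Present ω p ∧ Endless (Φ ω) p}

theorem IsRealization.measurableSet_endlessEvent (hΦ : IsRealization R μ ν ρ Φ) (p : V × ℕ) :
    MeasurableSet (endlessEvent Φ p) := by
  have : endlessEvent Φ p = {ω | Present ω p} ∩ ⋂ n : ℕ, ⋃ m : ℕ, {ω | (n : ℝ≥0) ≤ Φ ω p m} := by
    ext ω
    simp [endlessEvent, Endless]
  rw [this]
  exact (measurableSet_present p).inter (MeasurableSet.iInter fun n => MeasurableSet.iUnion fun m =>
    measurableSet_le measurable_const (hΦ.measurable p m))

theorem IsRealization.ae_endlessEvent (hΦ : IsRealization R μ ν ρ Φ)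
    (hν : IsInvariantPathLaw ν) (hR : Rule.IsInvariant G R) (γ : G ≃g G) (p : V × ℕ) :
    ∀ᵐ ω ∂inputLaw μ ν ρ, Input.map γ ω ∈ endlessEvent Φ (γ p.1, p.2) ↔ ω ∈ endlessEvent Φ p := by
  filter_upwards [hΦ.ae_input_map hν hR γ] with ω hω
  have hpres : Present (Input.map γ ω) (γ p.1, p.2) ↔ Present ω p := by
    rw [present_input_map]; simp
  refine and_congr_left_iff.2 ?_ |>.trans (and_congr_right fun hp => ?_)
  · exact fun _ => hpres
  · rw [Endless, Endless, hω p hp]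

/-- The event that the particle `p` exists and is at `v` at all large integer times. -/
def settleEvent (Φ : Input G S → V × ℕ → ℝ≥0 → ℝ≥0) (p : V × ℕ) (v : V) : Set (Input G S) :=
  {ω | Present ω p ∧ ∀ᶠ n : ℕ in atTop, position ω (Φ ω) p n = v}

theorem IsRealization.measurableSet_settleEvent (hΦ : IsRealization R μ ν ρ Φ) (p : V × ℕ) (v : V) :
    MeasurableSet (settleEvent Φ p v) := by
  have : settleEvent Φ p v = {ω | Present ω p} ∩ ⋃ n : ℕ, ⋂ k : ℕ, ⋂ (_ : n ≤ k),
      {ω | position ω (Φ ω) p k = v} := by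
    ext ω
    simp [settleEvent]
  rw [this]
  refine (measurableSet_present p).inter (MeasurableSet.iUnion fun n => MeasurableSet.iInter fun k =>
    MeasurableSet.iInter fun _ => ?_)
  exact measurableSet_path_eval_random
    (measurable_fst.comp ((measurable_pi_apply p).comp measurable_snd)) (hΦ.measurable p k) v

theorem IsRealization.ae_settleEvent (hΦ : IsRealization R μ ν ρ Φ)
    (hν : IsInvariantPathLaw ν) (hR : Rule.IsInvariant G R) (γ : G ≃g G) (p : V × ℕ) (v : V) :
    ∀ᵐ ω ∂inputLaw μ ν ρ,
      Input.map γ ω ∈ settleEvent Φ (γ p.1, p.2) (γ v) ↔ ω ∈ settleEvent Φ p v := by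
  filter_upwards [hΦ.ae_input_map hν hR γ] with ω hω
  have hpres : Present (Input.map γ ω) (γ p.1, p.2) ↔ Present ω p := by
    rw [present_input_map]; simp
  have hpath : ∀ s, ((Input.map γ ω).2 (γ p.1, p.2)).1.1 s = γ ((ω.2 p).1.1 s) := by
    intro s
    change γ ((ω.2 (γ.symm (γ p.1), p.2)).1.1 s) = _
    rw [γ.symm_apply_apply]
  refine and_congr_left_iff.2 ?_ |>.trans (and_congr_right fun hp => ?_)
  · exact fun _ => hpres
  · refine eventually_congr (Eventually.of_forall fun n => ?_)
    rw [position, position, hω p hp, hpath]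
    exact γ.injective.eq_iff

end Events

/-! ### Second moments and vanishing means -/

/-- A sum of random variables in `[0, 1]` with total mean at most `1`, each of which is
uncorrelated with all but `K` of them, has second moment at most `1 + K`. -/
theorem lintegral_sq_tsum_le {Ω ι : Type*} [MeasurableSpace Ω] [Countable ι] {P : Measure Ω}
    {h : ι → Ω → ℝ≥0∞} (hm : ∀ x, Measurable (h x)) (hle : ∀ x ω, h x ω ≤ 1)
    (near : ι → ι → Prop)
    (hind : ∀ x y, ¬ near x y → ∫⁻ ω, h x ω * h y ω ∂P = (∫⁻ ω, h x ω ∂P) * ∫⁻ ω, h y ω ∂P)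
    {K : ℕ∞} (hK : ∀ x, {y | near x y}.encard = K) (hsum : ∑' x, ∫⁻ ω, h x ω ∂P ≤ 1) :
    ∫⁻ ω, (∑' x, h x ω) ^ 2 ∂P ≤ 1 + K := by
  classical
  have hpair : ∀ x y, ∫⁻ ω, h x ω * h y ω ∂P ≤ (∫⁻ ω, h x ω ∂P) * (∫⁻ ω, h y ω ∂P) +
      Set.indicator {y | near x y} (fun _ => ∫⁻ ω, h x ω ∂P) y := by
    intro x y
    by_cases hxy : near x y
    · rw [Set.indicator_of_mem (show y ∈ {y | near x y} from hxy)]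
      refine le_add_left (lintegral_mono fun ω => ?_)
      exact mul_le_of_le_one_right' (hle y ω)
    · rw [hind x y hxy]
      exact le_self_add
  calc ∫⁻ ω, (∑' x, h x ω) ^ 2 ∂P = ∑' x, ∑' y, ∫⁻ ω, h x ω * h y ω ∂P := by
        simp_rw [sq, ← ENNReal.tsum_mul_right, ← ENNReal.tsum_mul_left]
        have hxy : ∀ x y, Measurable fun ω => h x ω * h y ω := fun x y => (hm x).mul (hm y)
        rw [lintegral_tsum fun x => (Measurable.tsum fun y => hxy x y).aemeasurable]
        exact tsum_congr fun x => lintegral_tsum fun y => (hxy x y).aemeasurable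
    _ ≤ ∑' x, ∑' y, ((∫⁻ ω, h x ω ∂P) * (∫⁻ ω, h y ω ∂P) +
          Set.indicator {y | near x y} (fun _ => ∫⁻ ω, h x ω ∂P) y) :=
        ENNReal.tsum_le_tsum fun x => ENNReal.tsum_le_tsum fun y => hpair x y
    _ = (∑' x, ∫⁻ ω, h x ω ∂P) * (∑' y, ∫⁻ ω, h y ω ∂P) + K * ∑' x, ∫⁻ ω, h x ω ∂P := by
        simp_rw [ENNReal.tsum_add, ENNReal.tsum_mul_left, ENNReal.tsum_mul_right]
        congr 1
        rw [← ENNReal.tsum_mul_left]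
        refine tsum_congr fun x => ?_
        rw [← tsum_subtype, ENNReal.tsum_set_const, hK]
    _ ≤ 1 * 1 + K * 1 := by gcongr
    _ = 1 + K := by simp

/-- Random variables `S n` that tend to `0` almost surely, with a common mean `a`, and are dominated
by an `L²`-bounded sequence up to an error of mean `ε`: then `a` is at most of order `ε`, because
an `L²`-bounded sequence is uniformly integrable. -/
theorem mean_le_of_tendsto_zero {Ω : Type*} [MeasurableSpace Ω] {P : Measure Ω}
    [IsProbabilityMeasure P] {S Z D : ℕ → Ω → ℝ≥0∞} {a C ε : ℝ≥0∞}
    (hS : ∀ n, Measurable (S n)) (hZ : ∀ n, Measurable (Z n)) (hD : ∀ n, Measurable (D n))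
    (hlim : ∀ᵐ ω ∂P, Tendsto (fun n => S n ω) atTop (nhds 0))
    (hmean : ∀ n, ∫⁻ ω, S n ω ∂P = a) (hle : ∀ n ω, S n ω ≤ Z n ω + D n ω)
    (hsq : ∀ n, ∫⁻ ω, Z n ω ^ 2 ∂P ≤ C) (hC : C ≠ ⊤) (hDε : ∀ n, ∫⁻ ω, D n ω ∂P ≤ ε)
    (hε0 : ε ≠ 0) (hε : ε ≠ ⊤) : a ≤ ε + ε + ε := by
  -- The truncation level is chosen so that `Z n` above it has mean at most `ε`.
  set M : ℝ≥0∞ := (C + 1) / ε with hM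
  have hM0 : M ≠ 0 := ENNReal.div_ne_zero.2 ⟨by simp, hε⟩
  have hMtop : M ≠ ⊤ := ENNReal.div_ne_top (by simp [hC]) hε0
  have hMC : M⁻¹ * C ≤ ε := by
    rw [hM, ENNReal.inv_div (Or.inl hε) (Or.inl hε0), ENNReal.div_eq_inv_mul, mul_assoc,
      mul_comm ε C, ← mul_assoc]
    refine mul_le_of_le_one_left' ?_
    refine (mul_le_mul_right (le_self_add (b := 1)) _).trans ?_
    rw [ENNReal.inv_mul_cancel (by simp) (by simp [hC])]
  let E : ℕ → Set Ω := fun n => {ω | ε < S n ω}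
  have hE : ∀ n, MeasurableSet (E n) := fun n => measurableSet_lt measurable_const (hS n)
  have hEind : ∀ n, Measurable ((E n).indicator fun _ => (1 : ℝ≥0∞)) := fun n =>
    measurable_const.indicator (hE n)
  have hEP : ∀ n, P (E n) = ∫⁻ ω, (E n).indicator (fun _ => (1 : ℝ≥0∞)) ω ∂P := fun n =>
    (lintegral_indicator_one (hE n)).symm
  have hElim : Tendsto (fun n => P (E n)) atTop (nhds 0) := by
    have := tendsto_lintegral_of_dominated_convergence (μ := P)
      (F := fun n => (E n).indicator fun _ => (1 : ℝ≥0∞)) (f := fun _ => 0) (fun _ => 1) hEind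
      (fun n => Eventually.of_forall fun ω => Set.indicator_le_self' (fun _ _ => zero_le) ω)
      (by simp) (by
        filter_upwards [hlim] with ω hω
        refine tendsto_const_nhds.congr' ?_
        filter_upwards [hω.eventually (ge_mem_nhds (pos_iff_ne_zero.2 hε0))] with n hn
        exact (Set.indicator_of_notMem (show ω ∉ E n from not_lt.2 hn) _).symm)
    simp_rw [hEP]
    simpa using this
  have hpt : ∀ n ω, S n ω ≤ ε + D n ω + M⁻¹ * Z n ω ^ 2 +
      M * (E n).indicator (fun _ => (1 : ℝ≥0∞)) ω := by
    intro n ω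
    by_cases hω : ω ∈ E n
    · rw [Set.indicator_of_mem hω, mul_one]
      have hZM : Z n ω ≤ M⁻¹ * Z n ω ^ 2 + M := by
        rcases le_total (Z n ω) M with h | h
        · exact le_add_left h
        · refine le_add_right ?_
          calc Z n ω = M⁻¹ * (M * Z n ω) := by
                rw [← mul_assoc, ENNReal.inv_mul_cancel hM0 hMtop, one_mul]
            _ ≤ M⁻¹ * Z n ω ^ 2 := by rw [sq]; gcongr
      calc S n ω ≤ Z n ω + D n ω := hle n ω
        _ ≤ (M⁻¹ * Z n ω ^ 2 + M) + D n ω := by gcongr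
        _ = D n ω + M⁻¹ * Z n ω ^ 2 + M := by ring
        _ ≤ ε + D n ω + M⁻¹ * Z n ω ^ 2 + M := by gcongr; exact le_add_self
    · refine le_trans (not_lt.1 hω) ?_
      rw [add_assoc, add_assoc]
      exact le_self_add
  have hbound : ∀ n, a ≤ ε + ε + ε + M * P (E n) := by
    intro n
    calc a = ∫⁻ ω, S n ω ∂P := (hmean n).symm
      _ ≤ ∫⁻ ω, (ε + D n ω + M⁻¹ * Z n ω ^ 2 +
            M * (E n).indicator (fun _ => (1 : ℝ≥0∞)) ω) ∂P := lintegral_mono (hpt n)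
      _ = ε + ∫⁻ ω, D n ω ∂P + M⁻¹ * ∫⁻ ω, Z n ω ^ 2 ∂P + M * P (E n) := by
          rw [lintegral_add_right _ ((hEind n).const_mul _),
            lintegral_add_right _ (((hZ n).pow_const 2).const_mul _),
            lintegral_add_right _ (hD n), lintegral_const_mul _ ((hZ n).pow_const 2),
            lintegral_const_mul _ (hEind n), ← hEP]
          simp
      _ ≤ ε + ε + M⁻¹ * C + M * P (E n) := by
          gcongr
          · exact hDε n
          · exact hsq n
      _ ≤ ε + ε + ε + M * P (E n) := by gcongr
  have hlimit : Tendsto (fun n => ε + ε + ε + M * P (E n)) atTop (nhds (ε + ε + ε + M * 0)) :=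
    tendsto_const_nhds.add (ENNReal.Tendsto.const_mul hElim (Or.inr hMtop))
  have := ge_of_tendsto' hlimit hbound
  simpa using this

/-! ### Endless particles -/

section Endless

variable {V S : Type*} {G : SimpleGraph V} [MeasurableSpace S] {R : Rule V S}
  {μ : ProbabilityMeasure ℕ} {ν : V → ProbabilityMeasure (Path G)} {ρ : ProbabilityMeasure S}
  {Φ : Input G S → V × ℕ → ℝ≥0 → ℝ≥0}

theorem measurable_weight_input [Countable V] (n : ℕ) (p : V × ℕ) (v : V) :
    Measurable fun ω : Input G S => weight n (ω.2 p).1 v :=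
  (measurable_weight n v).comp (measurable_fst.comp ((measurable_pi_apply p).comp measurable_snd))

/-- Let the `i`-th particle of every vertex `x` spread an equivariant random mass `D x` over the
sample of its putative path. Then the mean mass received by a vertex is the mean mass sent. -/
theorem tsum_lintegral_mul_weight (hG : IsUnimodularTransitive G) (hν : IsInvariantPathLaw ν)
    {D : V → Input G S → ℝ≥0∞} (hD : ∀ x, Measurable (D x))
    (hinv : ∀ (γ : G ≃g G) x, ∀ᵐ ω ∂inputLaw μ ν ρ, D (γ x) (Input.map γ ω) = D x ω)
    (n i : ℕ) (o : V) :
    ∑' x, ∫⁻ ω, D x ω * weight n (ω.2 (x, i)).1 o ∂inputLaw μ ν ρ =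
      ∫⁻ ω, D o ω ∂inputLaw μ ν ρ := by
  have := countable_vertices hG
  have hm : ∀ x v, Measurable fun ω => D x ω * weight n (ω.2 (x, i)).1 v := fun x v =>
    (hD x).mul (measurable_weight_input n (x, i) v)
  rw [← mass_transport hG (fun x v => ∫⁻ ω, D x ω * weight n (ω.2 (x, i)).1 v ∂inputLaw μ ν ρ) ?_ o]
  · rw [← lintegral_tsum fun v => (hm o v).aemeasurable]
    simp_rw [ENNReal.tsum_mul_left, tsum_weight, mul_one]
  · intro γ x v
    rw [← (measurePreserving_input_map μ ρ hν γ).lintegral_comp (hm (γ x) (γ v))]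
    refine lintegral_congr_ae ?_
    filter_upwards [hinv γ x] with ω hω
    have hpath : ((Input.map γ ω).2 (γ x, i)).1 = Path.map γ (ω.2 (x, i)).1 := by
      change Path.map γ (ω.2 (γ.symm (γ x), i)).1 = _
      rw [γ.symm_apply_apply]
    rw [hω, hpath, weight_map]

/-- In a vertex-fixating model, almost surely every vertex receives a vanishing mass from the
endless particles. -/
theorem tendsto_endless_mass [Countable V] (hrange : HasInfiniteRange ν)
    (hΦ : IsRealization R μ ν ρ Φ) (hfix : VertexFixating R μ ν ρ Φ) (i : ℕ) (o : V) :
    ∀ᵐ ω ∂inputLaw μ ν ρ, Tendsto (fun n => ∑' x,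
      (endlessEvent Φ (x, i)).indicator (fun _ => (1 : ℝ≥0∞)) ω * weight n (ω.2 (x, i)).1 o)
      atTop (nhds 0) := by
  have hinf : ∀ᵐ ω ∂inputLaw μ ν ρ, ∀ x, (Set.range (ω.2 (x, i)).1.1).Infinite :=
    ae_all_iff.2 fun x => ae_path μ ρ (x, i) (hrange x)
  filter_upwards [hΦ.solution, hΦ.isLocal, hfix o, hinf] with ω hs hl hf hi
  obtain ⟨T, hT⟩ := hf
  have hfin := (finite_endless_visitors hs hl hT).preimage
    (f := fun x : V => (x, i)) (fun a _ b _ h => congrArg Prod.fst h)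
  have hsum : ∀ n, ∑' x, (endlessEvent Φ (x, i)).indicator (fun _ => (1 : ℝ≥0∞)) ω *
      weight n (ω.2 (x, i)).1 o = ∑ x ∈ hfin.toFinset,
      (endlessEvent Φ (x, i)).indicator (fun _ => (1 : ℝ≥0∞)) ω * weight n (ω.2 (x, i)).1 o := by
    intro n
    refine tsum_eq_sum fun x hx => ?_
    by_cases hA : ω ∈ endlessEvent Φ (x, i)
    · rw [weight_eq_zero, mul_zero]
      intro hv
      exact hx (hfin.mem_toFinset.2 ⟨hA.1, hA.2, hv⟩)
    · rw [Set.indicator_of_notMem hA, zero_mul]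
  simp_rw [hsum]
  rw [← Finset.sum_const_zero (s := hfin.toFinset)]
  refine tendsto_finsetSum _ fun x _ => ?_
  rw [← mul_zero ((endlessEvent Φ (x, i)).indicator (fun _ => (1 : ℝ≥0∞)) ω)]
  refine ENNReal.Tendsto.const_mul (tendsto_weight (hi x) o) (Or.inr ?_)
  exact ne_top_of_le_ne_top ENNReal.one_ne_top (Set.indicator_le_self' (fun _ _ => zero_le) ω)

/-- In a vertex-fixating model almost surely no particle is endless. -/
theorem measure_endlessEvent (hG : IsUnimodularTransitive G) (hν : IsInvariantPathLaw ν)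
    (hrange : HasInfiniteRange ν) (hR : Rule.IsInvariant G R) (hΦ : IsRealization R μ ν ρ Φ)
    (hfix : VertexFixating R μ ν ρ Φ) (o : V) (i : ℕ) :
    inputLaw μ ν ρ (endlessEvent Φ (o, i)) = 0 := by
  have := countable_vertices hG
  set P := inputLaw μ ν ρ
  set a := P (endlessEvent Φ (o, i))
  by_contra ha0
  have ha_top : a ≠ ⊤ := measure_ne_top _ _
  have hAm : ∀ x, MeasurableSet (endlessEvent Φ (x, i)) := fun x =>
    hΦ.measurableSet_endlessEvent (x, i)
  let A : V → Input G S → ℝ := fun x => (endlessEvent Φ (x, i)).indicator fun _ => 1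
  have hAint : ∀ x, Integrable (A x) P := fun x => (integrable_const 1).indicator (hAm x)
  have hAinv : ∀ (γ : G ≃g G) x, (fun ω => A (γ x) (Input.map γ ω)) =ᵐ[P] A x := by
    intro γ x
    filter_upwards [hΦ.ae_endlessEvent hν hR γ (x, i)] with ω hω
    by_cases h : ω ∈ endlessEvent Φ (x, i)
    · simp only [A]; rw [Set.indicator_of_mem h, Set.indicator_of_mem (hω.2 h)]
    · simp only [A]; rw [Set.indicator_of_notMem h, Set.indicator_of_notMem (mt hω.1 h)]
  -- Approximation of the event by the input in a ball of a fixed radius `N` around the start.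
  have hε0 : a / 4 ≠ 0 := ENNReal.div_ne_zero.2 ⟨ha0, by simp⟩
  have hε_top : a / 4 ≠ ⊤ := ENNReal.div_ne_top ha_top (by simp)
  obtain ⟨N, hN⟩ : ∃ N, eLpNorm (P[A o | ballFiltration S G o N] - A o) 1 P ≤ a / 4 := by
    have hlevy := (hAint o).tendsto_eLpNorm_condExp (ℱ := ballFiltration S G o) (by
      rw [iSup_ballFiltration]
      exact (measurable_const.indicator (hAm o)).stronglyMeasurable)
    exact (hlevy.eventually (ge_mem_nhds (pos_iff_ne_zero.2 hε0))).exists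
  let c : V → Input G S → ℝ := fun x => P[A x | ballFiltration S G x N]
  have hc : ∀ x, Measurable[ballFiltration S G x N] (c x) := fun x =>
    stronglyMeasurable_condExp.measurable
  -- The conditional probability is at most `1` only almost surely; truncation makes it so everywhere.
  let g : V → Input G S → ℝ≥0∞ := fun x ω => min 1 (ENNReal.ofReal (c x ω))
  have hg : ∀ x, Measurable[ballFiltration S G x N] (g x) := fun x =>
    measurable_const.min (ENNReal.measurable_ofReal.comp (hc x))
  let D : V → Input G S → ℝ≥0∞ := fun x ω => ‖c x ω - A x ω‖ₑ
  have hDm : ∀ x, Measurable (D x) := fun x =>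
    (((hc x).mono ((ballFiltration S G x).le N) le_rfl).sub
      (measurable_const.indicator (hAm x))).enorm
  have hDinv : ∀ (γ : G ≃g G) x, ∀ᵐ ω ∂P, D (γ x) (Input.map γ ω) = D x ω := by
    intro γ x
    filter_upwards [hAinv γ x, condExp_input_map μ ρ hG.connected hν γ x N (hAint x) (hAint (γ x))
      (hAinv γ x)] with ω h1 h2
    simp only [D, c]
    rw [h1, h2]
  have hDo : ∫⁻ ω, D o ω ∂P ≤ a / 4 := by
    rw [eLpNorm_one_eq_lintegral_enorm] at hN
    exact hN
  let I : V → Input G S → ℝ≥0∞ := fun x => (endlessEvent Φ (x, i)).indicator fun _ => 1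
  have hIm : ∀ x, Measurable (I x) := fun x => measurable_const.indicator (hAm x)
  have hIinv : ∀ (γ : G ≃g G) x, ∀ᵐ ω ∂P, I (γ x) (Input.map γ ω) = I x ω := by
    intro γ x
    filter_upwards [hΦ.ae_endlessEvent hν hR γ (x, i)] with ω hω
    by_cases h : ω ∈ endlessEvent Φ (x, i)
    · simp only [I]; rw [Set.indicator_of_mem h, Set.indicator_of_mem (hω.2 h)]
    · simp only [I]; rw [Set.indicator_of_notMem h, Set.indicator_of_notMem (mt hω.1 h)]
  have hIle : ∀ x ω, I x ω ≤ g x ω + D x ω := by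
    intro x ω
    by_cases h : ω ∈ endlessEvent Φ (x, i)
    · simp only [I, g, D, A]
      rw [Set.indicator_of_mem h, Set.indicator_of_mem h]
      rcases le_total 1 (ENNReal.ofReal (c x ω)) with h1 | h1
      · rw [min_eq_left h1]
        exact le_self_add
      · rw [min_eq_right h1, Real.enorm_eq_ofReal_abs]
        refine le_trans ?_ ENNReal.ofReal_add_le
        rw [ENNReal.one_le_ofReal]
        linarith [neg_abs_le (c x ω - 1)]
    · simp only [I]
      rw [Set.indicator_of_notMem h]
      exact zero_le
  let w : ℕ → V → Input G S → ℝ≥0∞ := fun n x ω => weight n (ω.2 (x, i)).1 o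
  have hwm : ∀ n x, Measurable[ballFiltration S G x N] (w n x) := fun n x =>
    (measurable_weight n o).comp (measurable_path_localAlgebra (p := (x, i))
      (show G.dist x x ≤ N by simp))
  have hwm' : ∀ n x, Measurable (w n x) := fun n x => measurable_weight_input n (x, i) o
  have hgm' : ∀ x, Measurable (g x) := fun x => (hg x).mono ((ballFiltration S G x).le N) le_rfl
  have hIw : ∀ n x, Measurable fun ω => I x ω * w n x ω := fun n x => (hIm x).mul (hwm' n x)
  have hDw : ∀ n x, Measurable fun ω => D x ω * w n x ω := fun n x => (hDm x).mul (hwm' n x)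
  obtain ⟨K, hK⟩ := exists_encard_meeting_balls hG N
  have hsq : ∀ n, ∫⁻ ω, (∑' x, g x ω * w n x ω) ^ 2 ∂P ≤ 1 + ((K : ℕ∞) : ℝ≥0∞) := by
    intro n
    have hgw : ∀ x ω, g x ω * w n x ω ≤ w n x ω := fun x ω =>
      mul_le_of_le_one_left' (min_le_left _ _)
    refine lintegral_sq_tsum_le (fun x => (hgm' x).mul (hwm' n x))
      (fun x ω => (hgw x ω).trans (weight_le_one _ _ _))
      (fun x x' => ¬ Disjoint (ball G x N) (ball G x' N)) ?_ hK ?_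
    · intro x x' hdisj
      exact lintegral_mul_eq_lintegral_mul_lintegral_of_independent_measurableSpace
        ((ballFiltration S G x).le N) ((ballFiltration S G x').le N)
        (indep_localAlgebra μ ν ρ (not_not.1 hdisj)) ((hg x).mul (hwm n x))
        ((hg x').mul (hwm n x'))
    · have hone := tsum_lintegral_mul_weight (μ := μ) (ρ := ρ) hG hν (D := fun _ _ => 1)
        (fun _ => measurable_const) (fun _ _ => Eventually.of_forall fun _ => rfl) n i o
      simp only [one_mul, lintegral_one, measure_univ] at hone
      rw [← hone]
      exact ENNReal.tsum_le_tsum fun x => lintegral_mono (hgw x)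
  have hmain := mean_le_of_tendsto_zero (P := P) (a := a) (ε := a / 4)
    (S := fun n ω => ∑' x, I x ω * w n x ω) (Z := fun n ω => ∑' x, g x ω * w n x ω)
    (D := fun n ω => ∑' x, D x ω * w n x ω)
    (fun n => Measurable.tsum fun x => hIw n x)
    (fun n => Measurable.tsum fun x => (hgm' x).mul (hwm' n x))
    (fun n => Measurable.tsum fun x => hDw n x)
    (tendsto_endless_mass hrange hΦ hfix i o)
    (fun n => by
      rw [lintegral_tsum fun x => (hIw n x).aemeasurable,
        tsum_lintegral_mul_weight hG hν hIm hIinv]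
      exact lintegral_indicator_one (hAm o))
    (fun n ω => by
      rw [← ENNReal.tsum_add]
      refine ENNReal.tsum_le_tsum fun x => ?_
      rw [← add_mul]
      gcongr
      exact hIle x ω)
    hsq (by simp)
    (fun n => by
      rw [lintegral_tsum fun x => (hDw n x).aemeasurable,
        tsum_lintegral_mul_weight hG hν hDm hDinv]
      exact hDo)
    hε0 hε_top
  have hlt : a / 4 + a / 4 + a / 4 < a := by
    have h4 : a / 4 + a / 4 + a / 4 + a / 4 = a := by
      rw [ENNReal.div_add_div_same, ENNReal.div_add_div_same, ENNReal.div_add_div_same,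
        show a + a + a + a = a * 4 by ring]
      exact ENNReal.mul_div_cancel_right (by simp) (by simp)
    calc a / 4 + a / 4 + a / 4 < a / 4 + a / 4 + a / 4 + a / 4 :=
          ENNReal.lt_add_right (by simp [hε_top]) hε0
      _ = a := h4
  exact absurd hmain (not_le.2 hlt)

end Endless

/-! ### The density bound -/

section Density

variable {V S : Type*} {G : SimpleGraph V} [MeasurableSpace S] {R : Rule V S}
  {μ : ProbabilityMeasure ℕ} {ν : V → ProbabilityMeasure (Path G)} {ρ : ProbabilityMeasure S}
  {Φ : Input G S → V × ℕ → ℝ≥0 → ℝ≥0}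

/-- In a vertex-fixating model every particle fixates: it settles at some vertex, and wherever it
settles it fixates. -/
theorem ae_particle_fixation (hG : IsUnimodularTransitive G) (hν : IsInvariantPathLaw ν)
    (hrange : HasInfiniteRange ν) (hR : Rule.IsInvariant G R) (hΦ : IsRealization R μ ν ρ Φ)
    (hfix : VertexFixating R μ ν ρ Φ) :
    ∀ᵐ ω ∂inputLaw μ ν ρ, (∀ p, Present ω p → ∃ v, ω ∈ settleEvent Φ p v) ∧
      ∀ p v, ω ∈ settleEvent Φ p v → FixatesAt R ω (Φ ω) p v := by
  have := countable_vertices hG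
  have hend : ∀ᵐ ω ∂inputLaw μ ν ρ, ∀ p, ω ∉ endlessEvent Φ p :=
    ae_all_iff.2 fun p =>
      measure_eq_zero_iff_ae_notMem.1 (measure_endlessEvent hG hν hrange hR hΦ hfix p.1 p.2)
  filter_upwards [hΦ.solution, hend, ae_all_iff.2 hfix] with ω hs he hf
  have hpos : ∀ p, Present ω p → ∃ v T, ∀ t ≥ T, position ω (Φ ω) p t = v := fun p hp =>
    hs.exists_position_eq hp fun h => he p ⟨hp, h⟩
  have hlarge : ∀ T : ℝ≥0, ∀ᶠ n : ℕ in atTop, T ≤ n := fun T =>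
    tendsto_natCast_atTop_atTop.eventually (eventually_ge_atTop T)
  refine ⟨fun p hp => ?_, fun p v hpv => ?_⟩
  · obtain ⟨v, T, hT⟩ := hpos p hp
    exact ⟨v, hp, (hlarge T).mono fun n hn => hT n hn⟩
  · obtain ⟨v', T, hT⟩ := hpos p hpv.1
    obtain ⟨n, hn, hTn⟩ := (hpv.2.and (hlarge T)).exists
    obtain rfl : v' = v := (hT n hTn).symm.trans hn
    obtain ⟨T', hT'⟩ := hf v'
    refine ⟨hpv.1, max T T', fun t ht => ?_⟩
    have hpos_t := hT t ((le_max_left _ _).trans ht.le)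
    exact ⟨hT' t ((le_max_right _ _).trans_lt ht) p hpos_t, hpos_t⟩

/-- If every particle sends unit mass to the vertex where it settles, then a vertex sends mass
`meanDensity μ` on average, and receives at most `1`. -/
theorem meanDensity_le_one (hG : IsUnimodularTransitive G) (hν : IsInvariantPathLaw ν)
    (hrange : HasInfiniteRange ν) (hR : Rule.IsInvariant G R) (hΦ : IsRealization R μ ν ρ Φ)
    (hone : AtMostOneFixates R μ ν ρ Φ) (hfix : VertexFixating R μ ν ρ Φ) :
    meanDensity μ ≤ 1 := by
  have := countable_vertices hG
  obtain ⟨o⟩ := hG.connected.nonempty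
  have hm : ∀ p v, MeasurableSet (settleEvent Φ p v) := hΦ.measurableSet_settleEvent
  have hfixation := ae_particle_fixation hG hν hrange hR hΦ hfix
  let I : V × ℕ → V → Input G S → ℝ≥0∞ := fun p v => (settleEvent Φ p v).indicator fun _ => 1
  have hI : ∀ p v, Measurable (I p v) := fun p v => measurable_const.indicator (hm p v)
  have hIint : ∀ p v, ∫⁻ ω, I p v ω ∂inputLaw μ ν ρ = inputLaw μ ν ρ (settleEvent Φ p v) :=
    fun p v => lintegral_indicator_one (hm p v)
  have htransport := mass_transport hG
    (fun x v => ∑' i : ℕ, inputLaw μ ν ρ (settleEvent Φ (x, i) v)) (by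
      intro γ x v
      refine tsum_congr fun i => ?_
      rw [← (measurePreserving_input_map μ ρ hν γ).measure_preimage (hm _ _).nullMeasurableSet]
      refine measure_congr ?_
      filter_upwards [hΦ.ae_settleEvent hν hR γ (x, i) v] with ω hω
      exact propext hω) o
  have hout : meanDensity μ ≤ ∑' v, ∑' i : ℕ, inputLaw μ ν ρ (settleEvent Φ (o, i) v) := by
    rw [← lintegral_number μ ρ ν o]
    simp_rw [← hIint]
    rw [ENNReal.tsum_comm]
    simp_rw [← lintegral_tsum fun v => (hI _ v).aemeasurable]
    rw [← lintegral_tsum fun i => (Measurable.tsum fun v => hI (o, i) v).aemeasurable]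
    refine lintegral_mono_ae ?_
    filter_upwards [hfixation] with ω hω
    calc (ω.1 o : ℝ≥0∞) = ∑ i ∈ Finset.range (ω.1 o), 1 := by simp
      _ ≤ ∑ i ∈ Finset.range (ω.1 o), ∑' v, I (o, i) v ω := by
          refine Finset.sum_le_sum fun i hi => ?_
          obtain ⟨v, hv⟩ := hω.1 (o, i) (Finset.mem_range.1 hi)
          refine le_trans ?_ (ENNReal.le_tsum v)
          exact (Set.indicator_of_mem hv fun _ => (1 : ℝ≥0∞)).ge
      _ ≤ ∑' i, ∑' v, I (o, i) v ω := ENNReal.sum_le_tsum _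
  have hin : ∑' x, ∑' i : ℕ, inputLaw μ ν ρ (settleEvent Φ (x, i) o) ≤ 1 := by
    simp_rw [← hIint]
    rw [← ENNReal.tsum_prod (f := fun x i => ∫⁻ ω, I (x, i) o ω ∂inputLaw μ ν ρ),
      ← lintegral_tsum fun p => (hI p o).aemeasurable]
    refine le_trans (lintegral_mono_ae (g := fun _ => 1) ?_) (by simp)
    filter_upwards [hfixation, hone o] with ω hω hu
    by_cases hex : ∃ p, ω ∈ settleEvent Φ p o
    · obtain ⟨p, hp⟩ := hex
      rw [tsum_eq_single p fun q hq => Set.indicator_of_notMem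
        (fun hqo => hq (hu q p (hω.2 q o hqo) (hω.2 p o hp))) _]
      exact Set.indicator_le_self' (fun _ _ => zero_le) ω
    · push Not at hex
      rw [ENNReal.tsum_eq_zero.2 fun p => Set.indicator_of_notMem (hex p) _]
      exact zero_le
  exact hout.trans (htransport.trans_le hin)

theorem criticalDensity_le_one {M : Set (ProbabilityMeasure ℕ)}
    (h : ∀ μ ∈ M, ∀ Φ : Input G S → V × ℕ → ℝ≥0 → ℝ≥0, IsRealization R μ ν ρ Φ →
      VertexFixating R μ ν ρ Φ → meanDensity μ ≤ 1) :
    criticalDensity R ν ρ M ≤ 1 := by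
  refine sSup_le ?_
  rintro d ⟨μ, hμ, rfl, Φ, hΦ, hfix⟩
  exact h μ hμ Φ hΦ hfix

end Density

/-! ### Generalized activated random walk -/

section Garw

variable {V : Type*} {G : SimpleGraph V}

theorem isAlone_history_map {S : Type*} (γ : G ≃g G) (h : History V S) (p : V × ℕ)
    (x : ℝ≥0 → V) (s : ℝ≥0) :
    IsAlone (History.map γ h) (γ p.1, p.2) (fun r => γ (x r)) s ↔ IsAlone h p x s := by
  constructor
  · intro hal q hq z hz heq
    refine hal (γ q.1, q.2) ?_ (fun r => γ (z.1 r), z.2) ?_ (congrArg γ heq)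
    · intro h'
      exact hq (Prod.ext (γ.injective (congrArg Prod.fst h')) (congrArg Prod.snd h' :))
    · simp [History.map, hz]
  · intro hal q hq z hz heq
    obtain ⟨z', hz', rfl⟩ := Option.map_eq_some_iff.1 hz
    refine hal (γ.symm q.1, q.2) ?_ z' hz' (γ.injective heq)
    rintro rfl
    exact hq (by simp)

theorem garwRule_isInvariant (G : SimpleGraph V) : Rule.IsInvariant G (garwRule V) := by
  intro γ p t h
  have hmap : History.map γ h (γ p.1, p.2) =
      (h p).map fun z => (fun s => γ (z.1 s), z.2) := by
    simp [History.map]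
  unfold garwRule
  rw [hmap]
  cases hp : h p with
  | none => rfl
  | some z =>
    have halone := isAlone_history_map γ h p z.1
    classical
    refine if_congr (exists_congr fun s => and_congr_right fun _ => and_congr_right fun _ =>
      forall₂_congr fun r _ => halone r) rfl rfl

/-- A particle at rest is alone, so two particles cannot rest at the same vertex forever. -/
theorem garwRule_atMostOneFixates (μ : ProbabilityMeasure ℕ) (ν : V → ProbabilityMeasure (Path G))
    (ρ : ProbabilityMeasure (ℕ → ℝ)) (Φ : Input G (ℕ → ℝ) → V × ℕ → ℝ≥0 → ℝ≥0) :
    AtMostOneFixates (garwRule V) μ ν ρ Φ := by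
  refine fun v => Eventually.of_forall fun ω p q hp hq => ?_
  obtain ⟨hpres, T, hT⟩ := hp
  obtain ⟨hqres, T', hT'⟩ := hq
  by_contra hne
  set t := max T T' + 1
  have ht : t > max T T' := lt_add_one _
  obtain ⟨hact, hpv⟩ := hT t ((le_max_left _ _).trans_lt ht)
  obtain ⟨-, hqv⟩ := hT' t ((le_max_right _ _).trans_lt ht)
  refine hact ⟨hpres, ?_⟩
  simp only [rate, garwRule, historyUpTo, if_pos hpres]
  rw [if_neg]
  · exact one_pos
  · rintro ⟨s, hst, -, hal⟩
    refine hal t ⟨hst, le_rfl⟩ q (Ne.symm hne) _ (if_pos hqres) ?_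
    simp only [min_self]
    rw [hpv, hqv]

end Garw

end ARW

end

theorem corollary2 {V : Type*} [Infinite V] (G : SimpleGraph V)
    (hG : ARW.IsUnimodularTransitive G)
    (ν : V → ProbabilityMeasure (ARW.Path G))
    (hν : ARW.IsInvariantPathLaw ν) (hrange : ARW.HasInfiniteRange ν) :
    -- generalized activated random walks
    (∀ (r : ℝ) (hr : 0 < r),
      (∀ (μ : ProbabilityMeasure ℕ) (Φ : ARW.Input G (ℕ → ℝ) → V × ℕ → ℝ≥0 → ℝ≥0),
        ARW.IsRealization (ARW.garwRule V) μ ν (ARW.poissonClock r hr) Φ →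
        ARW.VertexFixating (ARW.garwRule V) μ ν (ARW.poissonClock r hr) Φ →
        ARW.meanDensity μ ≤ 1) ∧
      ∀ M : Set (ProbabilityMeasure ℕ),
        ARW.criticalDensity (ARW.garwRule V) ν (ARW.poissonClock r hr) M ≤ 1) ∧
    -- all models in which at most one particle can fixate at a vertex
    (∀ (S : Type*) [MeasurableSpace S] (ρ : ProbabilityMeasure S) (R : ARW.Rule V S),
      ARW.Rule.IsInvariant G R →
      (∀ (μ : ProbabilityMeasure ℕ) (Φ : ARW.Input G S → V × ℕ → ℝ≥0 → ℝ≥0),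
        ARW.IsRealization R μ ν ρ Φ →
        ARW.AtMostOneFixates R μ ν ρ Φ →
        ARW.VertexFixating R μ ν ρ Φ →
        ARW.meanDensity μ ≤ 1) ∧
      ∀ M : Set (ProbabilityMeasure ℕ),
        (∀ μ ∈ M, ∀ Φ, ARW.IsRealization R μ ν ρ Φ → ARW.AtMostOneFixates R μ ν ρ Φ) →
        ARW.criticalDensity R ν ρ M ≤ 1) := by
  refine ⟨fun r hr => ?_, fun S _ ρ R hR => ⟨fun μ Φ hΦ hone hfix =>
    ARW.meanDensity_le_one hG hν hrange hR hΦ hone hfix, fun M hM =>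
    ARW.criticalDensity_le_one fun μ hμ Φ hΦ hfix =>
      ARW.meanDensity_le_one hG hν hrange hR hΦ (hM μ hμ Φ hΦ) hfix⟩⟩
  have h : ∀ (μ : ProbabilityMeasure ℕ) (Φ : ARW.Input G (ℕ → ℝ) → V × ℕ → ℝ≥0 → ℝ≥0),
      ARW.IsRealization (ARW.garwRule V) μ ν (ARW.poissonClock r hr) Φ →
      ARW.VertexFixating (ARW.garwRule V) μ ν (ARW.poissonClock r hr) Φ →
      ARW.meanDensity μ ≤ 1 := fun μ Φ hΦ hfix =>
    ARW.meanDensity_le_one hG hν hrange (ARW.garwRule_isInvariant G) hΦ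
      (ARW.garwRule_atMostOneFixates μ ν _ Φ) hfix
  exact ⟨h, fun M => ARW.criticalDensity_le_one fun μ _ => h μ⟩
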